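/- Let $k$ be an algebraically closed field of characteristic zero, $G$ a finite abelian group, $\theta\ge 1$, $g_1,\dots,g_\theta\in G$, and $\chi_1,\dots,\chi_\theta: G\to k^\times$ characters such that $\chi_i(g_i)$ has order $n_i\ge 2$ for all $i$ and $\chi_j(g_i)\chi_i(g_j)=1$ for all $i\ne j$. Let $B=B(G,\underline g,\underline\chi)$ be the bosonization of the corresponding quantum linear space, i.e. the Hopf algebra over $k$ generated by the group $G$ (grouplike) and elements $x_1,\dots,x_\theta$ with $\Delta(x_i)=g_i\otimes x_i+x_i\otimes 1$, subject to the relations of $G$ and $$g x_i=\chi_i(g)x_i g\ (g\in G),\qquad x_i^{n_i}=0,\qquad x_ix_j=\chi_j(g_i)x_jx_i\ (i\neq j).$$ Let $B'$ be the Hopf subalgebra of $B$ generated by $g_1,\dots,g_\theta,x_1,\dots,x_\theta$, and $G'$ the subgroup of $G$ generated by $g_1,\dots,g_\theta$. A Hopf algebra $H$ over $k$ acts on a field $L\supseteq k$ if $L$ is a left $H$-module with $h\cdot(ab)=\sum (h_1\cdot a)(h_2\cdot b)$ and $h\cdot 1=\varepsilon(h)1$; the action is inner faithful if $IL\ne 0$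 for every nonzero Hopf ideal $I$ of $H$; $H$ is Galois-theoretical if it acts inner faithfully on some field containing $k$. For a subalgebra $A\subseteq H$ put $L^{A}=\{\ell\in L: h\cdot \ell=\varepsilon(h)\ell \text{ for all } h\in A\}$, and let $L^G$, $L^{G'}$ be the subfields of elements fixed by $G$, $G'$. Then $B$ is Galois-theoretical if and only if $B'$ is isomorphic, as a Hopf algebra, to a tensor product of finitely many (at least one) Hopf algebras, each of which is one of the following, where $\gamma$ is grouplike: - a Taft algebra $T(n,\zeta)$, $n\ge 2$, $\zeta$ a primitive $n$-th root of unity: generators $\gamma,x$; relations $\gamma^n=1$, $x^n=0$, $\gamma x=\zeta x\gamma$; $\Delta(x)=\gamma\otimes x+x\otimes 1$; - a Nichols Hopf algebra $E(n)$, $n\ge1$: generators $\gamma,x_1,\dots,x_n$; relations $\gamma^2=1$, $x_i^2=0$, $\gamma x_i=-x_i\gamma$, $x_ix_j=-x_jx_i$; $\Delta(x_i)=\gamma\otimes x_i+x_i\otimes 1$; - a book algebra $\mathbf h(\zeta,1)$, $\zeta$ a primitive $n$-th root of unity, $n\ge 2$: generators $\gamma,x,y$; relations $\gamma^n=1$,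 $x^n=y^n=0$, $\gamma x=\zeta x\gamma$, $\gamma y=\zeta y\gamma$, $xy=yx$; $\Delta(x)=1\otimes x+x\otimes \gamma$, $\Delta(y)=\gamma\otimes y+y\otimes 1$. In this case, for every field $L\supseteq k$ on which $B$ acts inner faithfully: (i) $L^B=L^G$, and $L$ is a finite Galois extension of this subfield; (ii) $L^{B'}=L^{G'}$, and $L$ is a finite Galois extension of this subfield. -/

import Mathlib

open scoped TensorProduct

universe u v w

/-! ### The vanishing case of the quantum binomial formula -/

/-- Gaussian binomial coefficients evaluated at `q`. -/
def gaussBinom {k : Type u} [Field k] (q : k) : ℕ → ℕ → k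
  | _, 0 => 1
  | 0, _ + 1 => 0
  | m + 1, j + 1 => gaussBinom q m j + q ^ (j + 1) * gaussBinom q m (j + 1)

theorem gaussBinom_zero_right {k : Type u} [Field k] (q : k) (m : ℕ) : gaussBinom q m 0 = 1 := by
  cases m <;> rfl

theorem gaussBinom_absorb {k : Type u} [Field k] (q : k) (m j : ℕ) :
    (1 - q ^ (j + 1)) * gaussBinom q (m + 1) (j + 1) = (1 - q ^ (m + 1)) * gaussBinom q m j := by
  induction m generalizing j with
  | zero =>
    cases j with
    | zero => simp [gaussBinom]
    | succ j => simp [gaussBinom]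
  | succ m ih =>
    have h0 := ih j
    rw [gaussBinom]
    cases j with
    | zero =>
      rw [gaussBinom_zero_right] at h0 ⊢
      linear_combination q * h0
    | succ j =>
      have h1 := ih j
      have h2 : gaussBinom q (m + 1) (j + 1)
          = gaussBinom q m j + q ^ (j + 1) * gaussBinom q m (j + 1) := by rw [gaussBinom]
      linear_combination q ^ (j + 2) * h0 - q * (1 - q ^ (m + 1)) * h2 + q * h1

theorem gaussBinom_eq_zero {k : Type u} [Field k] (q : k) (m j : ℕ) (h : m < j) :
    gaussBinom q m j = 0 := by
  induction m generalizing j with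
  | zero => cases j with
    | zero => omega
    | succ j => simp [gaussBinom]
  | succ m ih => cases j with
    | zero => omega
    | succ j => rw [gaussBinom, ih j (by omega), ih (j + 1) (by omega)]; simp

theorem add_pow_of_quasiCommute {k : Type u} [Field k] {A : Type v} [Ring A] [Algebra k A]
    (q : k) (a b : A) (hab : b * a = q • (a * b)) (m : ℕ) :
    (a + b) ^ m = ∑ j ∈ Finset.range (m + 1), gaussBinom q m j • (a ^ j * b ^ (m - j)) := by
  have hba : ∀ j : ℕ, b * a ^ j = q ^ j • (a ^ j * b) := by
    intro j
    induction j with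
    | zero => simp
    | succ j ih =>
      rw [pow_succ, ← mul_assoc, ih, smul_mul_assoc, mul_assoc, hab, mul_smul_comm, smul_smul,
        mul_assoc, ← pow_succ]
  induction m with
  | zero => simp [gaussBinom]
  | succ m ih =>
    rw [pow_succ', ih, add_mul, Finset.sum_range_succ' _ (m + 1)]
    have e1 : a * ∑ j ∈ Finset.range (m + 1), gaussBinom q m j • (a ^ j * b ^ (m - j))
        = ∑ j ∈ Finset.range (m + 1), gaussBinom q m j • (a ^ (j + 1) * b ^ (m - j)) := by
      rw [Finset.mul_sum]
      refine Finset.sum_congr rfl fun j _ => ?_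
      rw [mul_smul_comm, ← mul_assoc, ← pow_succ']
    have e2 : b * ∑ j ∈ Finset.range (m + 1), gaussBinom q m j • (a ^ j * b ^ (m - j))
        = ∑ j ∈ Finset.range (m + 1), (q ^ j * gaussBinom q m j) • (a ^ j * b ^ (m + 1 - j)) := by
      rw [Finset.mul_sum]
      refine Finset.sum_congr rfl fun j hj => ?_
      have : m + 1 - j = (m - j) + 1 := by
        have := Finset.mem_range.mp hj; omega
      rw [mul_smul_comm, ← mul_assoc, hba, smul_mul_assoc, mul_assoc, ← pow_succ', smul_smul,
        this, mul_comm (gaussBinom q m j)]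
    have e3 : ∑ j ∈ Finset.range (m + 1), (q ^ j * gaussBinom q m j) • (a ^ j * b ^ (m + 1 - j))
        = ∑ j ∈ Finset.range (m + 1),
            (q ^ (j + 1) * gaussBinom q m (j + 1)) • (a ^ (j + 1) * b ^ (m - j))
          + b ^ (m + 1) := by
      have h := Finset.sum_range_succ
        (fun j => (q ^ j * gaussBinom q m j) • (a ^ j * b ^ (m + 1 - j))) (m + 1)
      rw [gaussBinom_eq_zero q m (m + 1) (by omega)] at h
      rw [mul_zero, zero_smul, add_zero] at h
      rw [← h, Finset.sum_range_succ']
      simp [gaussBinom_zero_right]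
    rw [e1, e2, e3, ← add_assoc, ← Finset.sum_add_distrib]
    congr 1
    · refine Finset.sum_congr rfl fun j _ => ?_
      rw [← add_smul, gaussBinom]
      simp
    · simp [gaussBinom]

theorem add_pow_eq_zero_of_quasiCommute {k : Type u} [Field k] {A : Type v} [Ring A] [Algebra k A]
    {q : k} {n : ℕ} (hq : IsPrimitiveRoot q n) (hn : n ≠ 0) (a b : A)
    (hab : b * a = q • (a * b)) (ha : a ^ n = 0) (hb : b ^ n = 0) : (a + b) ^ n = 0 := by
  rw [add_pow_of_quasiCommute q a b hab]
  refine Finset.sum_eq_zero fun j hj => ?_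
  have hj' := Finset.mem_range.mp hj
  rcases Nat.eq_zero_or_pos j with rfl | hj0
  · simp [hb]
  rcases Nat.lt_or_ge j n with hjn | hjn
  · obtain ⟨i, rfl⟩ : ∃ i, j = i + 1 := ⟨j - 1, by omega⟩
    obtain ⟨m, rfl⟩ : ∃ m, n = m + 1 := ⟨n - 1, by omega⟩
    have h := gaussBinom_absorb q m i
    rw [hq.pow_eq_one, sub_self, zero_mul] at h
    have h1 : (1 - q ^ (i + 1)) ≠ 0 :=
      sub_ne_zero.mpr (Ne.symm (hq.pow_ne_one_of_pos_of_lt (by omega) hjn))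
    rw [(mul_eq_zero.mp h).resolve_left h1, zero_smul]
  · obtain rfl : j = n := by omega
    simp [ha]

/-! ### Pointed Hopf algebras presented by a group and quasi-commuting skew-primitives -/

/-- Data for a Hopf algebra generated by an abelian group `G` and elements `x i`, `i : ι`, with
`Δ (x i) = g i ⊗ x i + x i ⊗ h i`, subject to the relations of `G` and
`γ * x i = χ i γ • (x i * γ)`, `x i ^ N i = 0`, `x i * x j = c i j • (x j * x i)` for `i ≠ j`. The
three conditions say that these relations are compatible with the coproduct. -/
structure SkewDatum (k : Type u) [Field k] (G : Type v) [CommGroup G] (ι : Type w) where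
  g : ι → G
  h : ι → G
  χ : ι → G →* kˣ
  N : ι → ℕ
  c : ι → ι → kˣ
  two_le : ∀ i, 2 ≤ N i
  primitive : ∀ i, IsPrimitiveRoot (χ i (g i) * (χ i (h i))⁻¹) (N i)
  compat_left : ∀ i j, i ≠ j → χ j (g i) = c i j * χ i (h j)
  compat_right : ∀ i j, i ≠ j → χ j (h i) = c i j * χ i (g j)

namespace SkewDatum

variable {k : Type u} [Field k] {G : Type v} [CommGroup G] {ι : Type w}

/-- The defining relations, in the free algebra on the disjoint union of `G` and `ι`. -/
inductive Rel (D : SkewDatum k G ι) : FreeAlgebra k (G ⊕ ι) → FreeAlgebra k (G ⊕ ι) → Prop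
  | one : Rel D (FreeAlgebra.ι k (Sum.inl 1)) 1
  | mul (a b : G) : Rel D (FreeAlgebra.ι k (Sum.inl (a * b)))
      (FreeAlgebra.ι k (Sum.inl a) * FreeAlgebra.ι k (Sum.inl b))
  | conj (a : G) (i : ι) : Rel D (FreeAlgebra.ι k (Sum.inl a) * FreeAlgebra.ι k (Sum.inr i))
      ((D.χ i a : k) • (FreeAlgebra.ι k (Sum.inr i) * FreeAlgebra.ι k (Sum.inl a)))
  | nilp (i : ι) : Rel D (FreeAlgebra.ι k (Sum.inr i) ^ D.N i) 0
  | comm (i j : ι) (hij : i ≠ j) :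
      Rel D (FreeAlgebra.ι k (Sum.inr i) * FreeAlgebra.ι k (Sum.inr j))
        ((D.c i j : k) • (FreeAlgebra.ι k (Sum.inr j) * FreeAlgebra.ι k (Sum.inr i)))

/-- The algebra presented by the datum. -/
def Alg (D : SkewDatum k G ι) : Type (max u v w) := RingQuot (Rel D)

noncomputable instance (D : SkewDatum k G ι) : Ring D.Alg :=
  inferInstanceAs (Ring (RingQuot (Rel D)))

noncomputable instance (D : SkewDatum k G ι) : Algebra k D.Alg :=
  inferInstanceAs (Algebra k (RingQuot (Rel D)))

variable (D : SkewDatum k G ι)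

/-- The quotient map from the free algebra. -/
noncomputable def proj : FreeAlgebra k (G ⊕ ι) →ₐ[k] D.Alg := RingQuot.mkAlgHom k (Rel D)

/-- The skew-primitive generators. -/
noncomputable def x (i : ι) : D.Alg := D.proj (FreeAlgebra.ι k (Sum.inr i))

/-- The group-like generators. -/
noncomputable def of : G →* D.Alg where
  toFun a := D.proj (FreeAlgebra.ι k (Sum.inl a))
  map_one' := (RingQuot.mkAlgHom_rel k (Rel.one (D := D))).trans (map_one D.proj)
  map_mul' a b := (RingQuot.mkAlgHom_rel k (Rel.mul (D := D) a b)).trans (map_mul D.proj _ _)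

theorem of_mul_x (a : G) (i : ι) : D.of a * D.x i = (D.χ i a : k) • (D.x i * D.of a) := by
  have h := RingQuot.mkAlgHom_rel k (Rel.conj (D := D) a i)
  change D.proj _ = D.proj _ at h
  rwa [map_mul, map_smul, map_mul] at h

theorem x_pow (i : ι) : D.x i ^ D.N i = 0 := by
  have h := RingQuot.mkAlgHom_rel k (Rel.nilp (D := D) i)
  change D.proj _ = D.proj _ at h
  rwa [map_pow, map_zero] at h

theorem x_mul_x {i j : ι} (hij : i ≠ j) : D.x i * D.x j = (D.c i j : k) • (D.x j * D.x i) := by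
  have h := RingQuot.mkAlgHom_rel k (Rel.comm (D := D) i j hij)
  change D.proj _ = D.proj _ at h
  rwa [map_mul, map_smul, map_mul] at h

variable {D} in
/-- The universal property of the presentation. -/
noncomputable def lift {A : Type*} [Ring A] [Algebra k A] (φ : G →* A) (y : ι → A)
    (hconj : ∀ a i, φ a * y i = (D.χ i a : k) • (y i * φ a))
    (hnilp : ∀ i, y i ^ D.N i = 0)
    (hcomm : ∀ i j, i ≠ j → y i * y j = (D.c i j : k) • (y j * y i)) : D.Alg →ₐ[k] A :=
  RingQuot.liftAlgHom k ⟨FreeAlgebra.lift k (Sum.elim φ y), by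
    intro p q hpq
    induction hpq with
    | one => simp
    | mul a b => simp
    | conj a i => simpa using hconj a i
    | nilp i => simpa using hnilp i
    | comm i j hij => simpa using hcomm i j hij⟩

section lift

variable {D} {A : Type*} [Ring A] [Algebra k A] (φ : G →* A) (y : ι → A)
    (hconj : ∀ a i, φ a * y i = (D.χ i a : k) • (y i * φ a))
    (hnilp : ∀ i, y i ^ D.N i = 0)
    (hcomm : ∀ i j, i ≠ j → y i * y j = (D.c i j : k) • (y j * y i))

@[simp] theorem lift_of (a : G) : lift φ y hconj hnilp hcomm (D.of a) = φ a := by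
  refine (RingQuot.liftAlgHom_mkAlgHom_apply k _ _ _).trans ?_
  simp

@[simp] theorem lift_x (i : ι) : lift φ y hconj hnilp hcomm (D.x i) = y i := by
  refine (RingQuot.liftAlgHom_mkAlgHom_apply k _ _ _).trans ?_
  simp

end lift

variable {D} in
/-- An algebra map out of the presented algebra is determined on the generators. -/
theorem hom_ext {A : Type*} [Semiring A] [Algebra k A] {f₁ f₂ : D.Alg →ₐ[k] A}
    (h1 : ∀ a, f₁ (D.of a) = f₂ (D.of a)) (h2 : ∀ i, f₁ (D.x i) = f₂ (D.x i)) : f₁ = f₂ := by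
  refine RingQuot.ringQuot_ext' k f₁ f₂ (FreeAlgebra.hom_ext (funext fun s => ?_))
  cases s with
  | inl a => exact h1 a
  | inr i => exact h2 i

variable {D} in
theorem alg_induction {P : D.Alg → Prop} (hk : ∀ r : k, P (algebraMap k D.Alg r))
    (hof : ∀ a, P (D.of a)) (hx : ∀ i, P (D.x i)) (hmul : ∀ a b, P a → P b → P (a * b))
    (hadd : ∀ a b, P a → P b → P (a + b)) (a : D.Alg) : P a := by
  obtain ⟨p, rfl⟩ : ∃ p, D.proj p = a := RingQuot.mkAlgHom_surjective k _ a
  induction p using FreeAlgebra.induction with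
  | grade0 r => rw [AlgHom.commutes]; exact hk r
  | grade1 s => cases s with
    | inl a => exact hof a
    | inr i => exact hx i
  | mul a b ha hb => rw [map_mul]; exact hmul _ _ ha hb
  | add a b ha hb => rw [map_add]; exact hadd _ _ ha hb

/-! #### Bialgebra structure -/

theorem x_mul_of (a : G) (i : ι) :
    D.x i * D.of a = ((D.χ i a)⁻¹ : kˣ).val • (D.of a * D.x i) := by
  rw [of_mul_x, smul_smul, ← Units.val_mul, inv_mul_cancel, Units.val_one, one_smul]

/-- The group homomorphism `γ ↦ γ ⊗ γ`. -/
noncomputable def diag : G →* D.Alg ⊗[k] D.Alg where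
  toFun a := D.of a ⊗ₜ[k] D.of a
  map_one' := by simp [Algebra.TensorProduct.one_def]
  map_mul' := by simp

theorem diag_apply (a : G) : D.diag a = D.of a ⊗ₜ[k] D.of a := rfl

/-- The coproduct: `γ ↦ γ ⊗ γ` for `γ : G` and `x i ↦ g i ⊗ x i + x i ⊗ h i`. -/
noncomputable def comulHom : D.Alg →ₐ[k] D.Alg ⊗[k] D.Alg :=
  lift D.diag
    (fun i => D.of (D.g i) ⊗ₜ[k] D.x i + D.x i ⊗ₜ[k] D.of (D.h i))
    (by
      intro a i
      simp only [diag_apply, mul_add, add_mul,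
        Algebra.TensorProduct.tmul_mul_tmul, smul_add, of_mul_x, ← map_mul, mul_comm a,
        TensorProduct.tmul_smul, TensorProduct.smul_tmul'])
    (by
      intro i
      have hp : IsPrimitiveRoot (((D.χ i (D.g i)) * (D.χ i (D.h i))⁻¹ : kˣ) : k) (D.N i) :=
        (D.primitive i).map_of_injective (f := Units.coeHom k) Units.val_injective
      rw [add_comm]
      refine add_pow_eq_zero_of_quasiCommute hp (by have := D.two_le i; omega) _ _ ?_ ?_ ?_
      · rw [Algebra.TensorProduct.tmul_mul_tmul, Algebra.TensorProduct.tmul_mul_tmul,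
          D.of_mul_x (D.g i), D.x_mul_of (D.h i), TensorProduct.tmul_smul,
          ← TensorProduct.smul_tmul', smul_smul, mul_comm, ← Units.val_mul]
      · rw [Algebra.TensorProduct.tmul_pow, x_pow, TensorProduct.zero_tmul]
      · rw [Algebra.TensorProduct.tmul_pow, x_pow, TensorProduct.tmul_zero])
    (by
      intro i j hij
      have h1 := congrArg Units.val (D.compat_left i j hij)
      have h2 := congrArg Units.val (D.compat_right i j hij)
      rw [Units.val_mul] at h1 h2
      simp only [mul_add, add_mul, Algebra.TensorProduct.tmul_mul_tmul, smul_add]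
      rw [D.x_mul_x hij, D.of_mul_x (D.g i), D.of_mul_x (D.h i), D.of_mul_x (D.g j),
        D.of_mul_x (D.h j), ← map_mul, ← map_mul, ← map_mul, ← map_mul, mul_comm (D.g j),
        mul_comm (D.h j), h1, h2]
      simp only [TensorProduct.tmul_smul, ← TensorProduct.smul_tmul', smul_smul]
      abel)

/-- The counit: `γ ↦ 1` for `γ : G` and `x i ↦ 0`. -/
noncomputable def counitHom : D.Alg →ₐ[k] k :=
  lift 1 (fun _ => 0) (by simp)
    (fun i => zero_pow (by have := D.two_le i; omega)) (by simp)

@[simp] theorem comulHom_of (a : G) : D.comulHom (D.of a) = D.of a ⊗ₜ[k] D.of a := by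
  simp [comulHom, diag_apply]

@[simp] theorem comulHom_x (i : ι) :
    D.comulHom (D.x i) = D.of (D.g i) ⊗ₜ[k] D.x i + D.x i ⊗ₜ[k] D.of (D.h i) := by
  simp [comulHom]

@[simp] theorem counitHom_of (a : G) : D.counitHom (D.of a) = 1 := by simp [counitHom]

@[simp] theorem counitHom_x (i : ι) : D.counitHom (D.x i) = 0 := by simp [counitHom]

noncomputable instance : Bialgebra k D.Alg :=
  Bialgebra.ofAlgHom D.comulHom D.counitHom
    (hom_ext (by simp) (by simp [TensorProduct.add_tmul, TensorProduct.tmul_add, add_assoc]))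
    (hom_ext (by simp) (by simp))
    (hom_ext (by simp) (by simp))

@[simp] theorem comul_of (a : G) :
    Coalgebra.comul (R := k) (D.of a) = D.of a ⊗ₜ[k] D.of a := D.comulHom_of a

@[simp] theorem comul_x (i : ι) : Coalgebra.comul (R := k) (D.x i)
    = D.of (D.g i) ⊗ₜ[k] D.x i + D.x i ⊗ₜ[k] D.of (D.h i) := D.comulHom_x i

@[simp] theorem counit_of (a : G) : Coalgebra.counit (R := k) (D.of a) = 1 := D.counitHom_of a

@[simp] theorem counit_x (i : ι) : Coalgebra.counit (R := k) (D.x i) = 0 := D.counitHom_x i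

/-! #### Antipode -/

/-- The value of the antipode at a skew-primitive generator. -/
noncomputable def sx (i : ι) : D.Alg := -(D.of (D.g i)⁻¹ * D.x i * D.of (D.h i)⁻¹)

theorem sx_eq (i : ι) : D.sx i
    = (-((D.χ i (D.g i))⁻¹ : kˣ).val) • (D.x i * D.of ((D.g i)⁻¹ * (D.h i)⁻¹)) := by
  rw [sx, of_mul_x, smul_mul_assoc, mul_assoc, ← map_mul, neg_smul, map_inv]

theorem x_of_mul_x_of (i j : ι) (a b : G) : (D.x i * D.of a) * (D.x j * D.of b)
    = (D.χ j a : k) • (D.x i * D.x j * D.of (a * b)) := by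
  rw [mul_assoc, ← mul_assoc (D.of a), of_mul_x, smul_mul_assoc, mul_smul_comm, mul_assoc,
    ← map_mul, mul_assoc]

theorem x_of_pow (i : ι) (a : G) (n : ℕ) :
    ∃ r : k, (D.x i * D.of a) ^ n = r • (D.x i ^ n * D.of (a ^ n)) := by
  induction n with
  | zero => exact ⟨1, by simp⟩
  | succ n ih =>
    obtain ⟨r, hr⟩ := ih
    refine ⟨r * (D.χ i (a ^ n) : k), ?_⟩
    rw [pow_succ, hr, smul_mul_assoc, mul_assoc, ← mul_assoc (D.of (a ^ n)), of_mul_x,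
      smul_mul_assoc, mul_smul_comm, smul_smul, mul_assoc (D.x i), ← map_mul, ← mul_assoc,
      ← pow_succ, ← pow_succ]

/-- The group homomorphism `γ ↦ γ⁻¹` into the opposite algebra. -/
noncomputable def invOp : G →* (D.Alg)ᵐᵒᵖ where
  toFun a := MulOpposite.op (D.of a⁻¹)
  map_one' := by simp
  map_mul' a b := by rw [← MulOpposite.op_mul, ← map_mul, mul_inv_rev]

theorem invOp_apply (a : G) : D.invOp a = MulOpposite.op (D.of a⁻¹) := rfl

/-- The antipode as an algebra map to the opposite algebra: `γ ↦ γ⁻¹` for `γ : G` and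
`x i ↦ -(g i)⁻¹ * x i * (h i)⁻¹`. -/
noncomputable def antipodeHom : D.Alg →ₐ[k] (D.Alg)ᵐᵒᵖ :=
  lift D.invOp
    (fun i => MulOpposite.op (D.sx i))
    (by
      intro a i
      rw [invOp_apply, ← MulOpposite.op_mul, ← MulOpposite.op_mul, ← MulOpposite.op_smul]
      congr 1
      rw [sx_eq, smul_mul_assoc, mul_smul_comm, ← mul_assoc, D.of_mul_x a⁻¹, smul_mul_assoc,
        mul_assoc, mul_assoc, ← map_mul, ← map_mul, smul_comm, mul_comm a⁻¹, smul_smul, smul_smul,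
        map_inv]
      simp [mul_assoc])
    (by
      intro i
      rw [← MulOpposite.op_pow, sx_eq, smul_pow]
      obtain ⟨r, hr⟩ := D.x_of_pow i ((D.g i)⁻¹ * (D.h i)⁻¹) (D.N i)
      rw [hr, x_pow, zero_mul, smul_zero, smul_zero, MulOpposite.op_zero])
    (by
      intro i j hij
      rw [← MulOpposite.op_mul, ← MulOpposite.op_mul, ← MulOpposite.op_smul]
      congr 1
      have h1 := D.compat_left i j hij
      have h2 := D.compat_right i j hij
      have h3 : D.χ i ((D.g j)⁻¹ * (D.h j)⁻¹)
          = D.c i j * (D.χ j ((D.g i)⁻¹ * (D.h i)⁻¹) * D.c i j) := by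
        simp only [map_mul, map_inv]
        rw [h1, h2]
        have key : ∀ a b c : kˣ, a⁻¹ * b⁻¹ = c * ((c * b)⁻¹ * (c * a)⁻¹ * c) := by
          intro a b c
          ext
          push_cast
          field_simp
        exact key _ _ _
      have h4 := congrArg Units.val h3
      rw [Units.val_mul, Units.val_mul] at h4
      rw [sx_eq, sx_eq, smul_mul_smul_comm, smul_mul_smul_comm, x_of_mul_x_of, x_of_mul_x_of,
        D.x_mul_x hij, mul_comm ((D.g i)⁻¹ * (D.h i)⁻¹), h4]
      simp only [smul_mul_assoc, smul_smul]
      congr 1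
      ring)

/-- The antipode. -/
noncomputable def antipodeMap : D.Alg →ₗ[k] D.Alg :=
  (MulOpposite.opLinearEquiv k).symm.toLinearMap ∘ₗ D.antipodeHom.toLinearMap

@[simp] theorem antipodeMap_of (a : G) : D.antipodeMap (D.of a) = D.of a⁻¹ := by
  simp [antipodeMap, antipodeHom, invOp_apply]

@[simp] theorem antipodeMap_x (i : ι) : D.antipodeMap (D.x i) = D.sx i := by
  simp [antipodeMap, antipodeHom]

theorem antipodeMap_mul (a b : D.Alg) :
    D.antipodeMap (a * b) = D.antipodeMap b * D.antipodeMap a := by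
  simp [antipodeMap]

@[simp] theorem antipodeMap_algebraMap (r : k) :
    D.antipodeMap (algebraMap k D.Alg r) = algebraMap k D.Alg r := by
  simp [antipodeMap]

theorem of_mul_of_inv (a : G) : D.of a * D.of a⁻¹ = 1 := by rw [← map_mul, mul_inv_cancel, map_one]

theorem of_inv_mul_of (a : G) : D.of a⁻¹ * D.of a = 1 := by rw [← map_mul, inv_mul_cancel, map_one]

theorem antipode_left (a : D.Alg) :
    LinearMap.mul' k D.Alg (D.antipodeMap.rTensor D.Alg (Coalgebra.comul a))
      = algebraMap k D.Alg (Coalgebra.counit a) := by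
  have key : ∀ (r : k) (p q : D.Alg ⊗[k] D.Alg),
      LinearMap.mul' k D.Alg (D.antipodeMap.rTensor D.Alg p) = algebraMap k D.Alg r →
      LinearMap.mul' k D.Alg (D.antipodeMap.rTensor D.Alg (p * q))
        = r • LinearMap.mul' k D.Alg (D.antipodeMap.rTensor D.Alg q) := by
    intro r p q hp
    induction q with
    | zero => simp
    | add q₁ q₂ h₁ h₂ => simp only [mul_add, map_add, h₁, h₂, smul_add]
    | tmul c d =>
      have : ∀ p : D.Alg ⊗[k] D.Alg,
          LinearMap.mul' k D.Alg (D.antipodeMap.rTensor D.Alg (p * c ⊗ₜ[k] d))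
          = D.antipodeMap c * LinearMap.mul' k D.Alg (D.antipodeMap.rTensor D.Alg p) * d := by
        intro p
        induction p with
        | zero => simp
        | add p₁ p₂ h₁ h₂ => simp only [mul_add, add_mul, map_add, h₁, h₂]
        | tmul a b => simp [antipodeMap_mul, mul_assoc]
      rw [this, hp, ← Algebra.commutes, mul_assoc, ← Algebra.smul_def]
      simp
  induction a using alg_induction with
  | hk r => simp [Algebra.TensorProduct.algebraMap_apply]
  | hof a => simp [of_inv_mul_of]
  | hx i =>
    simp only [comul_x, map_add, LinearMap.rTensor_tmul, LinearMap.mul'_apply, antipodeMap_of,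
      antipodeMap_x, sx, counit_x, map_zero, neg_mul]
    rw [mul_assoc _ (D.of _), of_inv_mul_of, mul_one, add_neg_cancel]
  | hmul a b ha hb =>
    rw [Bialgebra.comul_mul, key _ _ _ ha, hb, Bialgebra.counit_mul, map_mul, Algebra.smul_def]
  | hadd a b ha hb => simp only [map_add, ha, hb]

theorem antipode_right (a : D.Alg) :
    LinearMap.mul' k D.Alg (D.antipodeMap.lTensor D.Alg (Coalgebra.comul a))
      = algebraMap k D.Alg (Coalgebra.counit a) := by
  have key : ∀ (r : k) (p q : D.Alg ⊗[k] D.Alg),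
      LinearMap.mul' k D.Alg (D.antipodeMap.lTensor D.Alg q) = algebraMap k D.Alg r →
      LinearMap.mul' k D.Alg (D.antipodeMap.lTensor D.Alg (p * q))
        = r • LinearMap.mul' k D.Alg (D.antipodeMap.lTensor D.Alg p) := by
    intro r p q hq
    induction p with
    | zero => simp
    | add q₁ q₂ h₁ h₂ => simp only [add_mul, map_add, h₁, h₂, smul_add]
    | tmul c d =>
      have : ∀ q : D.Alg ⊗[k] D.Alg,
          LinearMap.mul' k D.Alg (D.antipodeMap.lTensor D.Alg (c ⊗ₜ[k] d * q))
          = c * LinearMap.mul' k D.Alg (D.antipodeMap.lTensor D.Alg q) * D.antipodeMap d := by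
        intro q
        induction q with
        | zero => simp
        | add p₁ p₂ h₁ h₂ => simp only [mul_add, add_mul, map_add, h₁, h₂]
        | tmul a b => simp [antipodeMap_mul, mul_assoc]
      rw [this, hq, ← Algebra.commutes, mul_assoc, ← Algebra.smul_def]
      simp
  induction a using alg_induction with
  | hk r =>
    have h1 : D.antipodeMap 1 = 1 := by simpa using D.antipodeMap_algebraMap 1
    simp [Algebra.TensorProduct.algebraMap_apply, h1]
  | hof a => simp [of_mul_of_inv]
  | hx i =>
    simp only [comul_x, map_add, LinearMap.lTensor_tmul, LinearMap.mul'_apply, antipodeMap_of,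
      antipodeMap_x, sx, counit_x, map_zero, mul_neg]
    rw [mul_assoc (D.of _) (D.x i), ← mul_assoc, of_mul_of_inv, one_mul, neg_add_cancel]
  | hmul a b ha hb =>
    rw [Bialgebra.comul_mul, key _ _ _ hb, ha, Bialgebra.counit_mul, map_mul, Algebra.smul_def,
      Algebra.commutes]
  | hadd a b ha hb => simp only [map_add, ha, hb]

noncomputable instance : HopfAlgebra k D.Alg where
  antipode := D.antipodeMap
  mul_antipode_rTensor_comul := LinearMap.ext D.antipode_left
  mul_antipode_lTensor_comul := LinearMap.ext D.antipode_right

end SkewDatum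

/-! ### The Hopf algebras in the statement -/

/-- The data defining the bosonization `B(G, g, χ)` of a quantum linear space: `x i` is
`(g i, 1)`-skew-primitive, `γ * x i = χ i γ • (x i * γ)`, `x i ^ n i = 0` with `n i` the order of
`χ i (g i)`, and `x i * x j = χ j (g i) • (x j * x i)` for `i ≠ j`. -/
noncomputable def quantumLinearDatum {k : Type u} [Field k] {G : Type v} [CommGroup G] {θ : ℕ}
    (g : Fin θ → G) (χ : Fin θ → G →* kˣ) (hord : ∀ i, 2 ≤ orderOf (χ i (g i)))
    (hbr : ∀ i j, i ≠ j → χ j (g i) * χ i (g j) = 1) : SkewDatum k G (Fin θ) where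
  g := g
  h := fun _ => 1
  χ := χ
  N := fun i => orderOf (χ i (g i))
  c := fun i j => χ j (g i)
  two_le := hord
  primitive := fun i => by simpa using IsPrimitiveRoot.orderOf (χ i (g i))
  compat_left := fun i j _ => by simp
  compat_right := fun i j hij => by simpa using (hbr i j hij).symm

/-- The standard generator of the cyclic group of order `n`, written multiplicatively. -/
def cyclicGen (n : ℕ) : Multiplicative (ZMod n) := Multiplicative.ofAdd 1

/-- The character of the cyclic group of order `n` sending the standard generator to `ζ`. -/
def cyclicChar {k : Type u} [Field k] (n : ℕ) (ζ : kˣ) (hζ : ζ ^ n = 1) :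
    Multiplicative (ZMod n) →* kˣ :=
  AddMonoidHom.toMultiplicativeLeft
    (ZMod.lift n ⟨zmultiplesHom (Additive kˣ) (Additive.ofMul ζ), by
      rw [zmultiplesHom_apply, natCast_zsmul, ← ofMul_pow, hζ, ofMul_one]⟩)

@[simp] theorem cyclicChar_gen {k : Type u} [Field k] (n : ℕ) (ζ : kˣ) (hζ : ζ ^ n = 1) :
    cyclicChar n ζ hζ (cyclicGen n) = ζ := by
  have h := ZMod.lift_coe n ⟨zmultiplesHom (Additive kˣ) (Additive.ofMul ζ), by
      rw [zmultiplesHom_apply, natCast_zsmul, ← ofMul_pow, hζ, ofMul_one]⟩ 1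
  rw [Int.cast_one] at h
  exact (congrArg Additive.toMul h).trans (by simp)

/-- The data defining the Taft algebra `T(n, ζ)`: generators `γ`, `x` with `γ ^ n = 1`, `x ^ n = 0`,
`γ x = ζ x γ`, `Δ γ = γ ⊗ γ`, `Δ x = γ ⊗ x + x ⊗ 1`. -/
def taftDatum {k : Type u} [Field k] (n : ℕ) (hn : 2 ≤ n) (ζ : kˣ) (hζ : IsPrimitiveRoot ζ n) :
    SkewDatum k (Multiplicative (ZMod n)) Unit where
  g := fun _ => cyclicGen n
  h := fun _ => 1
  χ := fun _ => cyclicChar n ζ hζ.pow_eq_one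
  N := fun _ => n
  c := fun _ _ => 1
  two_le := fun _ => hn
  primitive := fun _ => by simpa using hζ
  compat_left := fun i j hij => absurd (Subsingleton.elim i j) hij
  compat_right := fun i j hij => absurd (Subsingleton.elim i j) hij

/-- The data defining the Nichols Hopf algebra `E(n)`: generators `γ`, `x₁, …, xₙ` with `γ ^ 2 = 1`,
`xᵢ ^ 2 = 0`, `γ xᵢ = - xᵢ γ`, `xᵢ xⱼ = - xⱼ xᵢ`, `Δ γ = γ ⊗ γ`, `Δ xᵢ = γ ⊗ xᵢ + xᵢ ⊗ 1`. -/
def nicholsDatum (k : Type u) [Field k] [CharZero k] (n : ℕ) :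
    SkewDatum k (Multiplicative (ZMod 2)) (Fin n) where
  g := fun _ => cyclicGen 2
  h := fun _ => 1
  χ := fun _ => cyclicChar 2 (-1) (by simp)
  N := fun _ => 2
  c := fun _ _ => -1
  two_le := fun _ => le_rfl
  primitive := fun _ => by
    have h : IsPrimitiveRoot (((-1 : kˣ) : k)) 2 := by
      rw [Units.val_neg, Units.val_one]
      exact IsPrimitiveRoot.neg_one 0 (by norm_num)
    simpa using IsPrimitiveRoot.coe_units_iff.mp h
  compat_left := fun i j _ => by simp
  compat_right := fun i j _ => by simp

/-- The data defining the book algebra `h(ζ, 1)`: generators `γ`, `x` (index `0`), `y` (index `1`)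
with `γ ^ n = 1`, `x ^ n = y ^ n = 0`, `γ x = ζ x γ`, `γ y = ζ y γ`, `x y = y x`, `Δ γ = γ ⊗ γ`,
`Δ x = 1 ⊗ x + x ⊗ γ`, `Δ y = γ ⊗ y + y ⊗ 1`. -/
def bookDatum {k : Type u} [Field k] (n : ℕ) (hn : 2 ≤ n) (ζ : kˣ) (hζ : IsPrimitiveRoot ζ n) :
    SkewDatum k (Multiplicative (ZMod n)) (Fin 2) where
  g := ![1, cyclicGen n]
  h := ![cyclicGen n, 1]
  χ := fun _ => cyclicChar n ζ hζ.pow_eq_one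
  N := fun _ => n
  c := fun _ _ => 1
  two_le := fun _ => hn
  primitive := fun i => by
    fin_cases i
    · simpa using hζ.inv
    · simpa using hζ
  compat_left := fun i j hij => by
    fin_cases i <;> fin_cases j <;> simp at hij ⊢
  compat_right := fun i j hij => by
    fin_cases i <;> fin_cases j <;> simp at hij ⊢

/-- `H` is a (finite, nonempty, iterated) tensor product of Taft algebras `T(n, ζ)` (`n ≥ 2`),
Nichols Hopf algebras `E(n)` (`n ≥ 1`) and book algebras `h(ζ, 1)` (`ζ` of order `n ≥ 2`). -/
inductive IsTaftNicholsBookTensor (k : Type u) [Field k] [CharZero k] :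
    (H : Type u) → [Semiring H] → [HopfAlgebra k H] → Prop
  | taft (n : ℕ) (hn : 2 ≤ n) (ζ : kˣ) (hζ : IsPrimitiveRoot ζ n) :
      IsTaftNicholsBookTensor k (taftDatum n hn ζ hζ).Alg
  | nichols (n : ℕ) (hn : 1 ≤ n) : IsTaftNicholsBookTensor k (nicholsDatum k n).Alg
  | book (n : ℕ) (hn : 2 ≤ n) (ζ : kˣ) (hζ : IsPrimitiveRoot ζ n) :
      IsTaftNicholsBookTensor k (bookDatum n hn ζ hζ).Alg
  | tensor (H₁ H₂ : Type u) [Semiring H₁] [HopfAlgebra k H₁] [Semiring H₂] [HopfAlgebra k H₂] :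
      IsTaftNicholsBookTensor k H₁ → IsTaftNicholsBookTensor k H₂ →
      IsTaftNicholsBookTensor k (H₁ ⊗[k] H₂)

/-! ### Hopf actions -/

/-- The `k`-linear map `h ↦ h • a`. -/
def orbitMap (k : Type u) (H : Type v) {A : Type w} [CommSemiring k] [Semiring H] [Algebra k H]
    [Semiring A] [Algebra k A] [Module H A] [IsScalarTower k H A] (a : A) : H →ₗ[k] A :=
  (LinearMap.toSpanSingleton H A a).restrictScalars k

/-- `H` acts on the algebra `A`: `h • (a b) = ∑ (h₁ • a) (h₂ • b)` and `h • 1 = ε(h) 1`. -/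
class IsHopfAction (k : Type u) (H : Type v) (A : Type w) [CommSemiring k] [Semiring H]
    [HopfAlgebra k H] [Semiring A] [Algebra k A] [Module H A] [IsScalarTower k H A] : Prop where
  smul_mul : ∀ (h : H) (a b : A), h • (a * b) =
    LinearMap.mul' k A (TensorProduct.map (orbitMap k H a) (orbitMap k H b) (Coalgebra.comul h))
  smul_one : ∀ h : H, h • (1 : A) = algebraMap k A (Coalgebra.counit h)

/-- The `H`-module `M` is inner faithful: `I M ≠ 0` for every nonzero Hopf ideal `I` of `H`. -/
def IsInnerFaithful (k : Type u) (H : Type v) (M : Type w) [Field k] [Ring H] [HopfAlgebra k H]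
    [AddCommGroup M] [Module H M] : Prop :=
  ∀ I : Ideal H, I.IsTwoSided → I.IsHopfIdeal k → I ≠ ⊥ → ∃ h ∈ I, ∃ m : M, h • m ≠ 0

/-- `H` acts inner faithfully on a field containing `k`. -/
def IsGaloisTheoretical (k : Type u) (H : Type v) [Field k] [Ring H] [HopfAlgebra k H] : Prop :=
  ∃ (L : Type (max u v)) (_ : Field L) (_ : Algebra k L) (_ : Module H L)
    (_ : IsScalarTower k H L), IsHopfAction k H L ∧ IsInnerFaithful k H L

/-- The invariants `{l | h • l = ε(h) l for all h ∈ A}` of a subalgebra `A` of `H` in an `H`-module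
field. -/
def hopfInvariants {k : Type u} {H : Type v} (L : Type w) [Field k] [Ring H] [HopfAlgebra k H]
    (A : Subalgebra k H) [Field L] [Algebra k L] [Module H L] : Set L :=
  {l | ∀ h ∈ A, h • l = algebraMap k L (Coalgebra.counit h) * l}

namespace SkewDatum

variable {k : Type u} [Field k] {G : Type v} [CommGroup G] {ι : Type w}

/-- The subfield of elements of an `H`-module field `L` which are fixed by the elements of a
subgroup `K` of `G`. -/
noncomputable def fixedField (D : SkewDatum k G ι) (L : Type*) [Field L] [Algebra k L]
    [Module D.Alg L] [IsScalarTower k D.Alg L] [IsHopfAction k D.Alg L] (K : Subgroup G) :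
    IntermediateField k L :=
  have hmul : ∀ (a : G) (l m : L), D.of a • (l * m) = (D.of a • l) * (D.of a • m) := by
    intro a l m
    rw [IsHopfAction.smul_mul (k := k), comul_of]
    simp [orbitMap]
  have hone : ∀ a : G, D.of a • (1 : L) = 1 := by
    intro a
    rw [IsHopfAction.smul_one (k := k), counit_of, map_one]
  { carrier := {l | ∀ a ∈ K, D.of a • l = l}
    mul_mem' := fun {l m} hl hm a ha => by rw [hmul, hl a ha, hm a ha]
    add_mem' := fun {l m} hl hm a ha => by rw [smul_add, hl a ha, hm a ha]
    algebraMap_mem' := fun r a _ => by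
      rw [Algebra.algebraMap_eq_smul_one, smul_algebra_smul_comm, hone]
    inv_mem' := fun l hl a ha => by
      rcases eq_or_ne l 0 with rfl | h0
      · simp
      · refine eq_inv_of_mul_eq_one_left ?_
        have h := hmul a l⁻¹ l
        rw [inv_mul_cancel₀ h0, hone, hl a ha] at h
        exact h.symm }

theorem mem_fixedField (D : SkewDatum k G ι) (L : Type*) [Field L] [Algebra k L]
    [Module D.Alg L] [IsScalarTower k D.Alg L] [IsHopfAction k D.Alg L] (K : Subgroup G) (l : L) :
    l ∈ D.fixedField L K ↔ ∀ a ∈ K, D.of a • l = l := Iff.rfl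

/-- The subalgebra generated by the `g i` and the `x i`. When all `h i` are `1` and the `g i` have
finite order, it is stable under the coproduct and the antipode, so it is the Hopf subalgebra
generated by these elements. -/
noncomputable def minimalSubalgebra (D : SkewDatum k G ι) : Subalgebra k D.Alg :=
  Algebra.adjoin k (Set.range (fun i => D.of (D.g i)) ∪ Set.range D.x)

end SkewDatum

/-!
Let `B` be the Hopf algebra of a quantum linear space, with skew-primitive generators `x i` of
type `(g i, 1)`, and let it act on a field `L`. Commutativity of `L` forces a skew-primitive element
`x i` to act as `b ↦ w i * (g i • b - b)` for some `w i : L`, because expanding `x i • (a * b)` and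
`x i • (b * a)` gives `(x i • a) * (g i • b - b) = (x i • b) * (g i • a - a)`.

Necessity. Evaluated on such operators, the defining relations of `B` are very restrictive. Since
`χ i (g i)` has order `n i` and `w i ≠ 0`, the relation `x i ^ n i = 0` forces `g i ^ n i` to act
trivially, and the relation between `x i` and `x j` forces `χ j (g i) = 1` or makes `g i * g j` act
trivially. A group-like element `t ≠ 1` acting trivially would give a nonzero Hopf ideal annihilating
`L`, so inner faithfulness yields `g i ^ n i = 1`, and `χ j (g i) = 1` or `g i * g j = 1`; this is
the condition `SkewDatum.IsRealizable`. `SkewDatum.isRealizable_of_isInnerFaithful` derives it from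
an inner faithful action of any Hopf algebra embedded in `B` whose image contains all `g i` and
`x i`, so it is available both for `B` and for tensor models of its minimal subalgebra.

Sufficiency. If a datum is realizable, its Hopf algebra acts on a field of rational functions over
`k`: the group permutes by translation a family of variables indexed by itself, which makes it act
faithfully, and scales further variables `w i` by the characters; `x i` acts as `w i` times the
difference operator of `g i`. The action is inner faithful (`SkewDatum.isInnerFaithful_ratField`)
since a Hopf ideal avoiding the elements of degree at most one is zero, as in the theorem of Heyneman
and Radford; here this is proved by pairing ordered monomials with functionals of degree at most one
and stripping off one factor at a time (`SkewDatum.IsTestFamily`).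

Shape of the minimal subalgebra. Taft, Nichols and book algebras are realizable, and so are tensor
products of realizable data (`SkewDatum.IsRealizable.prod`); hence a tensor product of such algebras
acts inner faithfully on a field, and if it is the minimal subalgebra of `B`, the argument for
necessity applies to this action and shows that `B` is realizable. Conversely, call two indices
related when `χ j (g i) ≠ 1`. In a realizable datum distinct related indices have mutually inverse
`g i`, so the class of `i` is a singleton (Taft), or consists of indices with `g i` of order two
(Nichols), or is a pair with group-likes `g` and `g⁻¹` (book). Indices in different classes do not
interact, which identifies the minimal subalgebra with the tensor product of these factors.

Invariants. In an inner faithful action `g i` acts nontrivially and `x i` acts as a multiple of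
`g i - 1`, so an element is invariant under `B` if and only if it is fixed by the group; the
extension is then finite Galois by Artin's theorem.
-/

/-! ### Operators of the form `b ↦ w * (τ b - b)` on a field -/

section TwistedDifference

variable {k : Type*} {L : Type*} [Field k] [Field L] [Algebra k L]

/-- The operator `b ↦ w * (τ b - b)`. Every skew-primitive element of a Hopf algebra acting on a
field acts by such an operator, `τ` being the action of the group-like element attached to it. -/
def twistedDiff (w : L) (τ : Module.End k L) : Module.End k L := LinearMap.mulLeft k w * (τ - 1)

@[simp] theorem twistedDiff_apply (w : L) (τ : Module.End k L) (b : L) :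
    twistedDiff w τ b = w * (τ b - b) := by
  simp [twistedDiff]

theorem twistedDiff_pow_apply {w : L} {τ : Module.End k L} {q : k}
    (hτ : ∀ a b, τ (a * b) = τ a * τ b) (hw : τ w = algebraMap k L q * w) (m : ℕ) (b : L) :
    (twistedDiff w τ ^ m) b = w ^ m * Polynomial.aeval τ
      (∏ j ∈ Finset.range m, (Polynomial.C (q ^ j) * Polynomial.X - 1)) b := by
  have hwm : ∀ m : ℕ, τ (w ^ (m + 1)) = algebraMap k L (q ^ (m + 1)) * w ^ (m + 1) := by
    intro m
    induction m with
    | zero => simpa using hw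
    | succ m ih => rw [pow_succ, hτ, ih, hw, map_pow, map_pow]; ring
  induction m with
  | zero => simp
  | succ m ih =>
    rw [pow_succ', Module.End.mul_apply, ih, twistedDiff_apply, Finset.prod_range_succ,
      mul_comm (Finset.prod _ _), map_mul (Polynomial.aeval τ), Module.End.mul_apply]
    set v := Polynomial.aeval τ (∏ j ∈ Finset.range m,
      (Polynomial.C (q ^ j) * Polynomial.X - 1)) b
    have h : τ (w ^ m * v) = algebraMap k L (q ^ m) * (w ^ m * τ v) := by
      cases m with
      | zero => simp
      | succ m => rw [hτ, hwm, mul_assoc]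
    have h' : Polynomial.aeval τ (Polynomial.C (q ^ m) * Polynomial.X - 1) v
        = algebraMap k L (q ^ m) * τ v - v := by
      rw [map_sub, map_mul, Polynomial.aeval_C, Polynomial.aeval_X, map_one, LinearMap.sub_apply,
        Module.End.mul_apply, Module.algebraMap_end_apply, Algebra.smul_def, Module.End.one_apply]
    rw [h, h']
    ring

theorem exists_prod_C_mul_X_sub_one {q : k} {n : ℕ} (hq : IsPrimitiveRoot q n) (hn : 0 < n) :
    ∃ c : k, c ≠ 0 ∧ ∏ j ∈ Finset.range n, (Polynomial.C (q ^ j) * Polynomial.X - 1)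
      = Polynomial.C c * (Polynomial.X ^ n - 1) := by
  have hq0 : q ≠ 0 := hq.ne_zero hn.ne'
  refine ⟨∏ j ∈ Finset.range n, q ^ j, Finset.prod_ne_zero_iff.mpr fun j _ => pow_ne_zero j hq0, ?_⟩
  have h := X_pow_sub_C_eq_prod hq.inv hn (one_pow n)
  rw [map_one] at h
  rw [h, map_prod, ← Finset.prod_mul_distrib]
  refine Finset.prod_congr rfl fun j _ => ?_
  rw [mul_sub, ← map_mul, mul_one, inv_pow, mul_inv_cancel₀ (pow_ne_zero j hq0), map_one]

theorem twistedDiff_pow_primitive {w : L} {τ : Module.End k L} {q : k} {n : ℕ}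
    (hτ : ∀ a b, τ (a * b) = τ a * τ b) (hw : τ w = algebraMap k L q * w)
    (hq : IsPrimitiveRoot q n) (hn : 0 < n) :
    ∃ c : k, c ≠ 0 ∧ ∀ b, (twistedDiff w τ ^ n) b = c • (w ^ n * ((τ ^ n) b - b)) := by
  obtain ⟨c, hc, h⟩ := exists_prod_C_mul_X_sub_one hq hn
  refine ⟨c, hc, fun b => ?_⟩
  rw [twistedDiff_pow_apply hτ hw, h]
  simp

/-- The failure of two twisted differences to quasi-commute is measured by `τ₁ ∘ τ₂ - 1`. -/
theorem twistedDiff_mul_sub {w₁ w₂ : L} {τ₁ τ₂ : Module.End k L} {q r : k}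
    (h₁ : ∀ a b, τ₁ (a * b) = τ₁ a * τ₁ b) (h₂ : ∀ a b, τ₂ (a * b) = τ₂ a * τ₂ b)
    (h₁₂ : τ₁ * τ₂ = τ₂ * τ₁) (hw₂ : τ₁ w₂ = algebraMap k L q * w₂)
    (hw₁ : τ₂ w₁ = algebraMap k L r * w₁) (hqr : q * r = 1) (b : L) :
    twistedDiff w₁ τ₁ (twistedDiff w₂ τ₂ b) - q • twistedDiff w₂ τ₂ (twistedDiff w₁ τ₁ b)
      = algebraMap k L (q - 1) * (w₁ * w₂) * (τ₁ (τ₂ b) - b) := by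
  have hc : τ₂ (τ₁ b) = τ₁ (τ₂ b) := (LinearMap.congr_fun h₁₂ b).symm
  have hqr' : algebraMap k L q * algebraMap k L r = 1 := by rw [← map_mul, hqr, map_one]
  simp only [twistedDiff_apply, h₁, h₂, hw₁, hw₂, map_sub, Algebra.smul_def, hc, map_one]
  linear_combination (-w₁ * w₂ * (τ₁ (τ₂ b) - τ₂ b)) * hqr'

end TwistedDifference

/-! ### Group-like and skew-primitive elements acting on fields -/

section Action

variable {k : Type u} {H : Type v} {L : Type w} [Field k] [Ring H] [HopfAlgebra k H] [Field L]
  [Algebra k L] [Module H L] [IsScalarTower k H L] [IsHopfAction k H L]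

theorem smul_mul_of_comul_tmul {t : H} (ht : Coalgebra.comul (R := k) t = t ⊗ₜ[k] t) (a b : L) :
    t • (a * b) = (t • a) * (t • b) := by
  rw [IsHopfAction.smul_mul (k := k), ht]
  simp [orbitMap]

theorem smul_mul_of_comul_skew {t y : H}
    (hy : Coalgebra.comul (R := k) y = t ⊗ₜ[k] y + y ⊗ₜ[k] 1) (a b : L) :
    y • (a * b) = (t • a) * (y • b) + (y • a) * b := by
  rw [IsHopfAction.smul_mul (k := k), hy]
  simp [orbitMap]

/-- As the field is commutative, expanding `y • (a * b) = y • (b * a)` shows that a skew-primitive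
element `y` acts by a multiple of the difference `t - 1`, as soon as `t` acts non-trivially. -/
theorem exists_smul_eq_mul_sub {t y : H}
    (hy : Coalgebra.comul (R := k) y = t ⊗ₜ[k] y + y ⊗ₜ[k] 1) (hnt : ∃ a : L, t • a ≠ a) :
    ∃ w : L, ∀ b : L, y • b = w * (t • b - b) := by
  obtain ⟨a, ha⟩ := hnt
  refine ⟨(y • a) / (t • a - a), fun b => ?_⟩
  have h1 := smul_mul_of_comul_skew hy a b
  rw [mul_comm a b, smul_mul_of_comul_skew hy b a] at h1
  have h2 : t • a - a ≠ 0 := sub_ne_zero.mpr ha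
  rw [div_mul_eq_mul_div, eq_div_iff h2]
  linear_combination -h1

theorem smul_weight {s t y : H} {q : k} {w : L}
    (hs : Coalgebra.comul (R := k) s = s ⊗ₜ[k] s) (hsu : IsUnit s)
    (hconj : s * y = q • (y * s)) (hst : s * t = t * s) (hw : ∀ b : L, y • b = w * (t • b - b))
    (hnt : ∃ a : L, t • a ≠ a) : s • w = algebraMap k L q * w := by
  obtain ⟨a, ha⟩ := hnt
  obtain ⟨s', hs'⟩ := hsu.exists_right_inv
  have h := congrArg (fun h : H => h • (s' • a)) hconj
  simp only [mul_smul, smul_assoc, hw] at h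
  rw [smul_mul_of_comul_tmul hs, smul_sub, ← mul_smul s t, hst, mul_smul t s, ← mul_smul s s',
    hs', one_smul, Algebra.smul_def, ← mul_assoc] at h
  exact mul_right_cancel₀ (sub_ne_zero.mpr ha) h

/-- The relations of a quantum linear space, imposed on operators on a field, force
`t i ^ n i` to act trivially, and `t i * t j` as well unless `q i j = 1`. -/
theorem relations_of_action {ι : Type*} {t y : ι → H} {q : ι → ι → k} {n : ι → ℕ}
    (ht : ∀ i, Coalgebra.comul (R := k) (t i) = t i ⊗ₜ[k] t i)
    (hy : ∀ i, Coalgebra.comul (R := k) (y i) = t i ⊗ₜ[k] y i + y i ⊗ₜ[k] 1)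
    (hu : ∀ i, IsUnit (t i)) (htt : ∀ i j, t i * t j = t j * t i)
    (hconj : ∀ i j, t i * y j = q i j • (y j * t i))
    (hq : ∀ i, IsPrimitiveRoot (q i i) (n i)) (hn : ∀ i, 0 < n i) (hnil : ∀ i, y i ^ n i = 0)
    (hcomm : ∀ i j, i ≠ j → y i * y j = q i j • (y j * y i))
    (hqq : ∀ i j, i ≠ j → q i j * q j i = 1)
    (hnt : ∀ i, ∃ a : L, t i • a ≠ a) (hny : ∀ i, ∃ a : L, y i • a ≠ 0) :
    (∀ i (a : L), t i ^ n i • a = a) ∧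
      ∀ i j, i ≠ j → q i j = 1 ∨ ∀ a : L, (t i * t j) • a = a := by
  choose w hw using fun i => exists_smul_eq_mul_sub (hy i) (hnt i)
  have hw0 : ∀ i, w i ≠ 0 := by
    intro i h0
    obtain ⟨a, ha⟩ := hny i
    exact ha (by rw [hw, h0, zero_mul])
  have hwt : ∀ i j, t i • w j = algebraMap k L (q i j) * w j := fun i j =>
    smul_weight (ht i) (hu i) (hconj i j) (htt i j) (hw j) (hnt j)
  let ρ : H →ₐ[k] Module.End k L := Algebra.lsmul k k L
  have hρ : ∀ (h : H) (a : L), ρ h a = h • a := fun h a => rfl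
  have hρy : ∀ i, ρ (y i) = twistedDiff (w i) (ρ (t i)) := fun i =>
    LinearMap.ext fun b => by rw [twistedDiff_apply, hρ, hρ, hw]
  have hmul : ∀ i (a b : L), ρ (t i) (a * b) = ρ (t i) a * ρ (t i) b := fun i a b =>
    smul_mul_of_comul_tmul (ht i) a b
  constructor
  · intro i a
    obtain ⟨c, hc, h⟩ := twistedDiff_pow_primitive (hmul i) (hwt i i) (hq i) (hn i)
    have h1 := h a
    rw [← hρy, ← map_pow, ← map_pow, hnil, map_zero, LinearMap.zero_apply, hρ, eq_comm,
      smul_eq_zero] at h1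
    have h2 := (mul_eq_zero.mp (h1.resolve_left hc)).resolve_left (pow_ne_zero _ (hw0 i))
    exact sub_eq_zero.mp h2
  · intro i j hij
    by_cases hq1 : q i j = 1
    · exact Or.inl hq1
    refine Or.inr fun a => ?_
    have h := twistedDiff_mul_sub (hmul i) (hmul j)
      (by rw [← map_mul, ← map_mul, htt]) (hwt i j) (hwt j i) (hqq i j hij) a
    rw [← hρy, ← hρy] at h
    have h1 : ρ (y i) (ρ (y j) a) = q i j • ρ (y j) (ρ (y i) a) := by
      rw [← Module.End.mul_apply, ← map_mul, hcomm i j hij, map_smul, map_mul]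
      rfl
    rw [h1, sub_self, eq_comm] at h
    have h2 : algebraMap k L (q i j - 1) * (w i * w j) ≠ 0 :=
      mul_ne_zero ((map_ne_zero _).mpr (sub_ne_zero.mpr hq1)) (mul_ne_zero (hw0 i) (hw0 j))
    rw [mul_smul]
    exact sub_eq_zero.mp ((mul_eq_zero.mp h).resolve_left h2)

end Action

/-! ### Consequences of inner faithfulness -/

section InnerFaithful

variable {k : Type u} {H : Type v} {M : Type w} [Field k] [Ring H] [HopfAlgebra k H]
  [AddCommGroup M] [Module H M]

/-- If an element `s` generates a Hopf ideal and kills an inner faithful module, then `s = 0`. -/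
theorem IsInnerFaithful.eq_zero (hM : IsInnerFaithful k H M) {s : H}
    (hε : Coalgebra.counit (R := k) s = 0)
    (hΔ : ∃ a b c d : H, Coalgebra.comul (R := k) s = (a * s * b) ⊗ₜ[k] c + d ⊗ₜ[k] s)
    (hS : ∃ a b : H, HopfAlgebra.antipode k s = a * s * b) (hs : ∀ m : M, s • m = 0) : s = 0 := by
  let I : Ideal H := Ideal.span (Set.range fun b => s * b)
  have hsb : ∀ b, s * b ∈ I := fun b => Ideal.subset_span ⟨b, rfl⟩
  have hasb : ∀ a b, a * s * b ∈ I := fun a b => by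
    rw [mul_assoc]; exact I.mul_mem_left a (hsb b)
  have hs1 : s ∈ I := by simpa using hsb 1
  have hI : I.IsTwoSided := ⟨fun {a} b ha => by
    induction ha using Submodule.span_induction with
    | mem x hx =>
      obtain ⟨c, rfl⟩ := hx
      simp only [mul_assoc]
      exact hsb _
    | zero => simp
    | add x y _ _ hx hy => rw [add_mul]; exact I.add_mem hx hy
    | smul r x _ hx => rw [smul_eq_mul, mul_assoc]; exact I.mul_mem_left r hx⟩
  by_contra hs0
  let π := Ideal.Quotient.mkₐ k I
  have hπ : ∀ x ∈ I, π x = 0 := fun x hx => Ideal.Quotient.eq_zero_iff_mem.mpr hx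
  have hπΔ : ∀ x ∈ I, Algebra.TensorProduct.map π π (Coalgebra.comul (R := k) x) = 0 := by
    intro x hx
    induction hx using Submodule.span_induction with
    | mem x hx =>
      obtain ⟨e, rfl⟩ := hx
      obtain ⟨a, b, c, d, h⟩ := hΔ
      simp only [Bialgebra.comul_mul, map_mul, h, map_add, Algebra.TensorProduct.map_tmul]
      simp [hπ s hs1]
    | zero => simp
    | add x y _ _ hx hy => rw [map_add, map_add, hx, hy, add_zero]
    | smul r x _ hx => rw [smul_eq_mul, Bialgebra.comul_mul, map_mul, hx, mul_zero]
  have hHopf : I.IsHopfIdeal k := by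
    refine (Ideal.isHopfIdeal_iff k I).mpr ⟨⟨fun x hx => ?_, fun x hx => hπΔ x hx⟩, fun x hx => ?_⟩
    · change x ∈ I at hx
      induction hx using Submodule.span_induction with
      | mem x hx =>
        obtain ⟨e, rfl⟩ := hx
        simp [Bialgebra.counit_mul, hε]
      | zero => simp
      | add x y _ _ hx hy => rw [map_add, hx, hy, add_zero]
      | smul r x _ hx => rw [smul_eq_mul, Bialgebra.counit_mul, hx, mul_zero]
    · induction hx using Submodule.span_induction with
      | mem x hx =>
        obtain ⟨e, rfl⟩ := hx
        obtain ⟨a, b, h⟩ := hS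
        simp only [HopfAlgebra.antipode_mul_antidistrib, h]
        simpa [mul_assoc] using hasb (HopfAlgebra.antipode k e * a) b
      | zero => simp
      | add x y _ _ hx hy => rw [map_add]; exact I.add_mem hx hy
      | smul r x _ hx =>
        rw [smul_eq_mul, HopfAlgebra.antipode_mul_antidistrib]
        exact I.mul_mem_right _ hx
  obtain ⟨h, hh, m, hm⟩ := hM I hI hHopf fun hbot => hs0 (by simpa [hbot] using hs1)
  refine hm ?_
  clear hm
  induction hh using Submodule.span_induction with
  | mem x hx =>
    obtain ⟨e, rfl⟩ := hx
    simp only [mul_smul, hs]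
  | zero => simp
  | add x y _ _ hx hy => rw [add_smul, hx, hy, add_zero]
  | smul r x _ hx => rw [smul_eq_mul, mul_smul, hx, smul_zero]

theorem antipode_eq_of_grouplike {t t' : H} (ht : Coalgebra.comul (R := k) t = t ⊗ₜ[k] t)
    (hε : Coalgebra.counit (R := k) t = 1) (htt : t * t' = 1) : HopfAlgebra.antipode k t = t' := by
  have h := HopfAlgebra.mul_antipode_rTensor_comul_apply (R := k) t
  rw [ht, hε] at h
  simp only [LinearMap.rTensor_tmul, LinearMap.mul'_apply, map_one] at h
  exact left_inv_eq_right_inv h htt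

/-- A group-like element acting trivially on an inner faithful module is `1`. -/
theorem IsInnerFaithful.eq_one_of_grouplike (hM : IsInnerFaithful k H M) {t : H}
    (ht : Coalgebra.comul (R := k) t = t ⊗ₜ[k] t) (hε : Coalgebra.counit (R := k) t = 1)
    (hu : IsUnit t) (h : ∀ m : M, t • m = m) : t = 1 := by
  obtain ⟨t', h1⟩ := hu.exists_right_inv
  have h2 : t' * t = 1 := by
    obtain ⟨t'', h3⟩ := hu.exists_left_inv
    rwa [← left_inv_eq_right_inv h3 h1]
  refine sub_eq_zero.mp (hM.eq_zero (s := t - 1) (by simp [hε]) ⟨1, 1, t, 1, ?_⟩ ⟨-t', 1, ?_⟩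
    fun m => by rw [sub_smul, h, one_smul, sub_self])
  · rw [map_sub, ht, Bialgebra.comul_one, Algebra.TensorProduct.one_def, one_mul, mul_one,
      TensorProduct.sub_tmul, TensorProduct.tmul_sub]
    abel
  · rw [map_sub, antipode_eq_of_grouplike ht hε h1, HopfAlgebra.antipode_one, mul_one, neg_mul,
      mul_sub, h2, mul_one, neg_sub]

/-- A skew-primitive element annihilating an inner faithful module is `0`. -/
theorem IsInnerFaithful.eq_zero_of_skew (hM : IsInnerFaithful k H M) {t y : H}
    (ht : Coalgebra.comul (R := k) t = t ⊗ₜ[k] t) (hε : Coalgebra.counit (R := k) t = 1)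
    (hu : IsUnit t) (hy : Coalgebra.comul (R := k) y = t ⊗ₜ[k] y + y ⊗ₜ[k] 1)
    (hεy : Coalgebra.counit (R := k) y = 0) (h : ∀ m : M, y • m = 0) : y = 0 := by
  obtain ⟨t', h1⟩ := hu.exists_right_inv
  refine hM.eq_zero hεy ⟨1, 1, 1, t, ?_⟩ ⟨-t', 1, ?_⟩ h
  · rw [hy, one_mul, mul_one, add_comm]
  · have h3 := HopfAlgebra.mul_antipode_rTensor_comul_apply (R := k) y
    rw [hy, hεy] at h3
    simp only [LinearMap.rTensor_tmul, LinearMap.mul'_apply, map_zero, map_add, mul_one,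
      antipode_eq_of_grouplike ht hε h1] at h3
    rw [mul_one, neg_mul]
    exact eq_neg_of_add_eq_zero_right h3

end InnerFaithful

/-! ### Ordered monomials in a presented Hopf algebra -/

namespace SkewDatum

section Monomials

variable {k : Type u} [Field k] {G : Type v} [CommGroup G] {ι : Type w} (D : SkewDatum k G ι)

theorem of_mul_x_pow (γ : G) (i : ι) (m : ℕ) :
    D.of γ * D.x i ^ m = ((D.χ i γ : k) ^ m) • (D.x i ^ m * D.of γ) := by
  induction m with
  | zero => simp
  | succ m ih =>
    rw [pow_succ, ← mul_assoc, ih, smul_mul_assoc, mul_assoc, of_mul_x, mul_smul_comm, smul_smul,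
      mul_assoc, pow_succ]

theorem x_mul_x_pow {i j : ι} (hij : i ≠ j) (m : ℕ) :
    D.x i * D.x j ^ m = ((D.c i j : k) ^ m) • (D.x j ^ m * D.x i) := by
  induction m with
  | zero => simp
  | succ m ih =>
    rw [pow_succ, ← mul_assoc, ih, smul_mul_assoc, mul_assoc, x_mul_x D hij, mul_smul_comm,
      smul_smul, mul_assoc, pow_succ]

theorem primitive_of_h_eq_one (hh : ∀ i, D.h i = 1) (i : ι) :
    IsPrimitiveRoot (D.χ i (D.g i) : k) (D.N i) := by
  have h := D.primitive i
  rw [hh, map_one, inv_one, mul_one] at h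
  exact h.map_of_injective (f := Units.coeHom k) Units.val_injective

theorem N_pos (i : ι) : 0 < D.N i := by have := D.two_le i; omega

theorem g_ne_one (hh : ∀ i, D.h i = 1) (i : ι) : D.g i ≠ 1 := fun h0 => by
  have h1 := D.primitive_of_h_eq_one hh i
  rw [h0, map_one, Units.val_one] at h1
  have h2 := h1.unique IsPrimitiveRoot.one
  have h3 := D.two_le i
  omega

/-- The monomial `∏ x i ^ a i * γ`, the product being taken in the order in which the indices occur
in the list `l`. -/
noncomputable def monomial (l : List ι) (a : ι → ℕ) (γ : G) : D.Alg :=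
  (l.map fun i => D.x i ^ a i).prod * D.of γ

@[simp] theorem monomial_nil (a : ι → ℕ) (γ : G) : D.monomial [] a γ = D.of γ := by
  simp [monomial]

@[simp] theorem monomial_cons (i : ι) (l : List ι) (a : ι → ℕ) (γ : G) :
    D.monomial (i :: l) a γ = D.x i ^ a i * D.monomial l a γ := by
  simp [monomial, mul_assoc]

theorem monomial_congr {l : List ι} {a b : ι → ℕ} (h : ∀ i ∈ l, a i = b i) (γ : G) :
    D.monomial l a γ = D.monomial l b γ := by
  induction l with
  | nil => simp
  | cons i l ih =>
    rw [monomial_cons, monomial_cons, h i (by simp), ih fun j hj => h j (by simp [hj])]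

theorem monomial_eq_zero {l : List ι} {a : ι → ℕ} {i : ι} (hi : i ∈ l) (h : D.N i ≤ a i) (γ : G) :
    D.monomial l a γ = 0 := by
  induction l with
  | nil => simp at hi
  | cons j l ih =>
    rw [monomial_cons]
    rcases List.mem_cons.mp hi with rfl | hi
    · rw [← Nat.sub_add_cancel h, pow_add, x_pow, mul_zero, zero_mul]
    · rw [ih hi, mul_zero]

theorem exists_of_mul_monomial (l : List ι) (a : ι → ℕ) (γ : G) :
    ∃ r : k, r ≠ 0 ∧ ∀ δ, D.of γ * D.monomial l a δ = r • D.monomial l a (γ * δ) := by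
  induction l with
  | nil => exact ⟨1, one_ne_zero, by simp⟩
  | cons i l ih =>
    obtain ⟨r, hr, h⟩ := ih
    refine ⟨(D.χ i γ : k) ^ a i * r, mul_ne_zero (pow_ne_zero _ (Units.ne_zero _)) hr, fun δ => ?_⟩
    rw [monomial_cons, ← mul_assoc, of_mul_x_pow, smul_mul_assoc, mul_assoc, h, mul_smul_comm,
      smul_smul, monomial_cons]

theorem exists_x_mul_monomial [DecidableEq ι] {l : List ι} (hl : l.Nodup) {i : ι} (hi : i ∈ l)
    (a : ι → ℕ) (γ : G) : ∃ r : k, D.x i * D.monomial l a γ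
      = r • D.monomial l (Function.update a i (a i + 1)) γ := by
  induction l with
  | nil => simp at hi
  | cons j l ih =>
    obtain ⟨hj, hl⟩ := List.nodup_cons.mp hl
    by_cases hij : i = j
    · subst hij
      refine ⟨1, ?_⟩
      rw [monomial_cons, monomial_cons, ← mul_assoc, ← pow_succ', one_smul,
        Function.update_self]
      congr 1
      refine D.monomial_congr (fun j' hj' => ?_) γ
      rw [Function.update_of_ne]
      rintro rfl
      exact hj hj'
    · obtain ⟨r, h⟩ := ih hl ((List.mem_cons.mp hi).resolve_left hij)
      refine ⟨(D.c i j : k) ^ a j * r, ?_⟩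
      rw [monomial_cons, ← mul_assoc, x_mul_x_pow D hij, smul_mul_assoc, mul_assoc, h,
        mul_smul_comm, smul_smul, monomial_cons, Function.update_of_ne (Ne.symm hij)]

/-- The ordered monomials with exponents below the `N i` span. -/
theorem span_monomial_eq_top {l : List ι} (hl : l.Nodup) (hmem : ∀ i, i ∈ l) :
    Submodule.span k (Set.range fun p : {a : ι → ℕ // ∀ i, a i < D.N i} × G =>
      D.monomial l p.1.1 p.2) = ⊤ := by
  classical
  set S := Submodule.span k (Set.range fun p : {a : ι → ℕ // ∀ i, a i < D.N i} × G =>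
      D.monomial l p.1.1 p.2) with hS
  have hmon : ∀ a γ, D.monomial l a γ ∈ S := by
    intro a γ
    by_cases ha : ∀ i, a i < D.N i
    · exact Submodule.subset_span ⟨⟨⟨a, ha⟩, γ⟩, rfl⟩
    · push Not at ha
      obtain ⟨i, hi⟩ := ha
      rw [D.monomial_eq_zero (hmem i) hi]
      exact S.zero_mem
  have hstable : ∀ h s : D.Alg, s ∈ S → h * s ∈ S := by
    intro h
    induction h using alg_induction with
    | hk r =>
      intro s hs
      rw [← Algebra.smul_def]
      exact S.smul_mem r hs
    | hof γ =>
      intro s hs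
      induction hs using Submodule.span_induction with
      | mem s hs =>
        obtain ⟨p, rfl⟩ := hs
        obtain ⟨r, -, h⟩ := D.exists_of_mul_monomial l p.1.1 γ
        rw [h]
        exact S.smul_mem r (hmon _ _)
      | zero => rw [mul_zero]; exact S.zero_mem
      | add s t _ _ hs ht => rw [mul_add]; exact S.add_mem hs ht
      | smul r s _ hs => rw [mul_smul_comm]; exact S.smul_mem r hs
    | hx i =>
      intro s hs
      induction hs using Submodule.span_induction with
      | mem s hs =>
        obtain ⟨p, rfl⟩ := hs
        obtain ⟨r, h⟩ := D.exists_x_mul_monomial hl (hmem i) p.1.1 p.2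
        rw [h]
        exact S.smul_mem r (hmon _ _)
      | zero => rw [mul_zero]; exact S.zero_mem
      | add s t _ _ hs ht => rw [mul_add]; exact S.add_mem hs ht
      | smul r s _ hs => rw [mul_smul_comm]; exact S.smul_mem r hs
    | hmul a b ha hb => exact fun s hs => by rw [mul_assoc]; exact ha _ (hb _ hs)
    | hadd a b ha hb => exact fun s hs => by rw [add_mul]; exact S.add_mem (ha _ hs) (hb _ hs)
  refine Submodule.eq_top_iff'.mpr fun h => ?_
  have h1 : (1 : D.Alg) ∈ S := by
    have h2 := hmon (fun _ => 0) 1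
    rwa [show D.monomial l (fun _ => 0) 1 = 1 by
      simp [monomial]] at h2
  simpa using hstable h 1 h1

end Monomials

/-! ### Detecting elements by functionals of degree at most one -/

section TestFunctionals

variable {k : Type u} [Field k] {G : Type v} [CommGroup G] {ι : Type w} {D : SkewDatum k G ι}

/-- The operator `h ↦ ∑ f(h₂) h₁` attached to a linear functional `f`. -/
noncomputable def hit {H : Type*} [Ring H] [Bialgebra k H] (f : H →ₗ[k] k) : H →ₗ[k] H :=
  (TensorProduct.rid k H).toLinearMap ∘ₗ f.lTensor H ∘ₗ Coalgebra.comul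

theorem hit_x_mul (hh : ∀ i, D.h i = 1) (f : D.Alg →ₗ[k] k) (j : ι) (h : D.Alg) :
    hit f (D.x j * h) = D.x j * hit f h
      + D.of (D.g j) * hit (f ∘ₗ LinearMap.mulLeft k (D.x j)) h := by
  have key : ∀ (a b : D.Alg) (t : D.Alg ⊗[k] D.Alg),
      TensorProduct.rid k D.Alg (f.lTensor D.Alg (a ⊗ₜ[k] b * t))
        = a * TensorProduct.rid k D.Alg
          ((f ∘ₗ LinearMap.mulLeft k b).lTensor D.Alg t) := by
    intro a b t
    induction t with
    | zero => simp
    | tmul c d => simp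
    | add s t hs ht => simp only [mul_add, map_add, hs, ht]
  simp only [hit, LinearMap.comp_apply, LinearEquiv.coe_coe, Bialgebra.comul_mul, comul_x, hh,
    map_one, add_mul, map_add, key]
  rw [add_comm]
  congr 4
  ext
  simp

theorem hit_of (f : D.Alg →ₗ[k] k) (γ : G) : hit f (D.of γ) = f (D.of γ) • D.of γ := by
  simp [hit]

theorem hit_sub (f f' : D.Alg →ₗ[k] k) (h : D.Alg) : hit (f - f') h = hit f h - hit f' h := by
  simp [hit, LinearMap.lTensor_sub]

/-- A family of functionals behaving like the coordinates along `γ` and along `g i⁻¹ γ`-differences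
of `x i * γ`: on `x i * γ` the functional `f i δ` has value `1` if `δ = g i * γ`, value `-1` if
`δ = γ`, and it vanishes on monomials of degree different from `1`. -/
structure IsTestFamily [DecidableEq ι] [DecidableEq G] (D : SkewDatum k G ι)
    (f₀ : G → D.Alg →ₗ[k] k) (f : ι → G → D.Alg →ₗ[k] k) : Prop where
  zero_of : ∀ γ δ, f₀ δ (D.of γ) = if γ = δ then 1 else 0
  zero_x : ∀ δ j h, f₀ δ (D.x j * h) = 0
  of : ∀ i γ δ, f i δ (D.of γ) = 0
  x_self : ∀ i δ h, f i δ (D.x i * h) = f₀ ((D.g i)⁻¹ * δ) h - f₀ δ h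
  x_ne : ∀ i j δ h, j ≠ i → f i δ (D.x j * h) = 0

variable [DecidableEq ι] [DecidableEq G] {f₀ : G → D.Alg →ₗ[k] k} {f : ι → G → D.Alg →ₗ[k] k}

namespace IsTestFamily

theorem zero_monomial (hf : IsTestFamily D f₀ f) (l : List ι) (a : ι → ℕ) (γ δ : G) :
    f₀ δ (D.monomial l a γ) = if (∀ i ∈ l, a i = 0) ∧ γ = δ then 1 else 0 := by
  induction l with
  | nil => simp [hf.zero_of]
  | cons i l ih =>
    rw [monomial_cons]
    rcases Nat.eq_zero_or_pos (a i) with h0 | h0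
    · rw [h0, pow_zero, one_mul, ih]
      simp [h0]
    · rw [← Nat.sub_add_cancel h0, pow_succ', mul_assoc, hf.zero_x, if_neg]
      rintro ⟨h1, -⟩
      have := h1 i (by simp)
      omega

theorem hit_zero_x_pow_mul (hf : IsTestFamily D f₀ f) (hh : ∀ i, D.h i = 1)
    (δ : G) (j : ι) (m : ℕ) (h : D.Alg) :
    hit (f₀ δ) (D.x j ^ m * h) = D.x j ^ m * hit (f₀ δ) h := by
  induction m with
  | zero => simp
  | succ m ih =>
    have h0 : f₀ δ ∘ₗ LinearMap.mulLeft k (D.x j) = 0 := LinearMap.ext fun h => hf.zero_x δ j h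
    rw [pow_succ', mul_assoc, hit_x_mul hh, ih, h0, mul_assoc]
    simp [hit]

theorem hit_zero_monomial (hf : IsTestFamily D f₀ f) (hh : ∀ i, D.h i = 1)
    (l : List ι) (a : ι → ℕ) (γ δ : G) :
    hit (f₀ δ) (D.monomial l a γ) = (if γ = δ then (1 : k) else 0) • D.monomial l a γ := by
  induction l with
  | nil => rw [monomial_nil, hit_of, hf.zero_of]
  | cons i l ih => rw [monomial_cons, hf.hit_zero_x_pow_mul hh, ih, mul_smul_comm]

theorem hit_x_pow_mul_of_ne (hf : IsTestFamily D f₀ f) (hh : ∀ i, D.h i = 1)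
    {i j : ι} (hij : j ≠ i) (δ : G) (m : ℕ)
    (h : D.Alg) : hit (f i δ) (D.x j ^ m * h) = D.x j ^ m * hit (f i δ) h := by
  induction m with
  | zero => simp
  | succ m ih =>
    have h0 : f i δ ∘ₗ LinearMap.mulLeft k (D.x j) = 0 :=
      LinearMap.ext fun h => hf.x_ne i j δ h hij
    rw [pow_succ', mul_assoc, hit_x_mul hh, ih, h0, mul_assoc]
    simp [hit]

theorem hit_x_pow_mul (hf : IsTestFamily D f₀ f) (hh : ∀ i, D.h i = 1)
    (i : ι) (δ : G) {h : D.Alg} {e : k}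
    (he : ∀ m, hit (f₀ ((D.g i)⁻¹ * δ)) (D.x i ^ m * h) - hit (f₀ δ) (D.x i ^ m * h)
      = e • (D.x i ^ m * h)) (m : ℕ) :
    hit (f i δ) (D.x i ^ m * h) = D.x i ^ m * hit (f i δ) h
      + (e * ∑ s ∈ Finset.range m, (D.χ i (D.g i) : k) ^ s) •
        (D.x i ^ (m - 1) * (D.of (D.g i) * h)) := by
  induction m with
  | zero => simp
  | succ m ih =>
    have h0 : f i δ ∘ₗ LinearMap.mulLeft k (D.x i) = f₀ ((D.g i)⁻¹ * δ) - f₀ δ :=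
      LinearMap.ext fun h => hf.x_self i δ h
    rw [pow_succ', mul_assoc, hit_x_mul hh, ih, h0, hit_sub, he, mul_smul_comm,
      ← mul_assoc (D.of _), of_mul_x_pow, Finset.sum_range_succ, mul_add, mul_add, add_smul,
      add_assoc, ← mul_assoc, smul_mul_assoc, smul_smul, mul_assoc, mul_smul_comm, mul_assoc]
    congr 2
    cases m with
    | zero => simp
    | succ m => rw [← mul_assoc, ← pow_succ']; rfl

theorem hit_monomial_of_notMem (hf : IsTestFamily D f₀ f) (hh : ∀ i, D.h i = 1)
    {l : List ι} {i : ι} (hi : i ∉ l)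
    (a : ι → ℕ) (γ δ : G) : hit (f i δ) (D.monomial l a γ) = 0 := by
  induction l with
  | nil => rw [monomial_nil, hit_of, hf.of, zero_smul]
  | cons j l ih =>
    rw [List.mem_cons, not_or] at hi
    rw [monomial_cons, hf.hit_x_pow_mul_of_ne hh (Ne.symm hi.1), ih hi.2, mul_zero]

/-- The operator attached to `f i δ` lowers the exponent of `x i` by one. -/
theorem hit_monomial (hf : IsTestFamily D f₀ f) (hh : ∀ i, D.h i = 1)
    {l : List ι} (hl : l.Nodup) {i : ι} (hi : i ∈ l)
    (a : ι → ℕ) (γ δ : G) : ∃ r : k, r ≠ 0 ∧ hit (f i δ) (D.monomial l a γ)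
      = (r * ((if γ = (D.g i)⁻¹ * δ then 1 else 0) - if γ = δ then 1 else 0)
          * ∑ s ∈ Finset.range (a i), (D.χ i (D.g i) : k) ^ s) •
        D.monomial l (Function.update a i (a i - 1)) (D.g i * γ) := by
  induction l with
  | nil => simp at hi
  | cons j l ih =>
    obtain ⟨hj, hl⟩ := List.nodup_cons.mp hl
    by_cases hij : i = j
    · subst hij
      obtain ⟨r, hr, h⟩ := D.exists_of_mul_monomial l a (D.g i)
      refine ⟨r, hr, ?_⟩
      rw [monomial_cons, hf.hit_x_pow_mul hh (e := (if γ = (D.g i)⁻¹ * δ then 1 else 0)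
          - if γ = δ then 1 else 0), hf.hit_monomial_of_notMem hh hj, mul_zero, zero_add, h,
        mul_smul_comm, smul_smul, monomial_cons, Function.update_self]
      · congr 1
        · ring
        · congr 1
          refine D.monomial_congr (fun j' hj' => ?_) _
          rw [Function.update_of_ne]
          rintro rfl
          exact hj hj'
      · intro m
        rw [hf.hit_zero_x_pow_mul hh, hf.hit_zero_x_pow_mul hh, hf.hit_zero_monomial hh,
          hf.hit_zero_monomial hh, mul_smul_comm, mul_smul_comm, sub_smul]
    · obtain ⟨r, hr, h⟩ := ih hl ((List.mem_cons.mp hi).resolve_left hij)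
      refine ⟨r, hr, ?_⟩
      rw [monomial_cons, hf.hit_x_pow_mul_of_ne hh (Ne.symm hij), h, mul_smul_comm, monomial_cons,
        Function.update_of_ne (Ne.symm hij)]

/-- Iterating the operators attached to the functionals of degree one yields a family dual to the
monomials, up to nonzero scalars, which vanishes on `I`. -/
theorem exists_dual (hf : IsTestFamily D f₀ f) (hh : ∀ i, D.h i = 1)
    {I : Submodule k D.Alg}
    (h₀ : ∀ δ, ∀ h ∈ I, f₀ δ h = 0) (h₁ : ∀ i δ, ∀ h ∈ I, hit (f i δ) h ∈ I)
    {l : List ι} (hl : l.Nodup) (hmem : ∀ i, i ∈ l) (a : ι → ℕ) (ha : ∀ i, a i < D.N i) (γ : G) :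
    ∃ F : D.Alg →ₗ[k] k, (∀ h ∈ I, F h = 0) ∧ F (D.monomial l a γ) ≠ 0 ∧
      ∀ b : ι → ℕ, (∀ i, b i < D.N i) → ∀ γ' : G, ¬ (b = a ∧ γ' = γ) →
        F (D.monomial l b γ') = 0 := by
  induction hn : (l.map a).sum generalizing a γ with
  | zero =>
    have ha0 : ∀ i, a i = 0 := fun i => by
      have := List.single_le_sum (l := l.map a) (by simp) (a i) (List.mem_map_of_mem (hmem i))
      omega
    refine ⟨f₀ γ, h₀ γ, ?_, fun b _ γ' hb => ?_⟩
    · rw [hf.zero_monomial, if_pos ⟨fun i _ => ha0 i, rfl⟩]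
      exact one_ne_zero
    · rw [hf.zero_monomial, if_neg]
      rintro ⟨h1, h2⟩
      exact hb ⟨funext fun i => by rw [h1 i (hmem i), ha0], h2⟩
  | succ n ih =>
    obtain ⟨i, hi⟩ : ∃ i, 0 < a i := by
      by_contra! h0
      have : (l.map a).sum = 0 := by
        rw [List.sum_eq_zero_iff]
        intro x hx
        obtain ⟨i, -, rfl⟩ := List.mem_map.mp hx
        exact Nat.le_zero.mp (h0 i)
      omega
    have hsum : (l.map (Function.update a i (a i - 1))).sum = n := by
      have h1 : (l.map a).sum = (l.map (Function.update a i (a i - 1))).sum + 1 := by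
        clear hn ih
        have hil := hmem i
        clear hmem
        induction l with
        | nil => simp at hil
        | cons j l ih =>
          obtain ⟨hj, hl⟩ := List.nodup_cons.mp hl
          rw [List.map_cons, List.map_cons, List.sum_cons, List.sum_cons]
          by_cases hij : i = j
          · subst hij
            have h2 : l.map (Function.update a i (a i - 1)) = l.map a := by
              refine List.map_congr_left fun j' hj' => ?_
              rw [Function.update_of_ne]
              rintro rfl
              exact hj hj'
            rw [h2, Function.update_self]
            omega
          · rw [ih hl ((List.mem_cons.mp hil).resolve_left hij),
              Function.update_of_ne (Ne.symm hij)]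
            omega
      omega
    have hlt : ∀ b : ι → ℕ, (∀ j, b j < D.N j) → ∀ j, Function.update b i (b i - 1) j < D.N j := by
      intro b hb j
      by_cases hj : j = i
      · subst hj
        rw [Function.update_self]
        exact lt_of_le_of_lt (Nat.sub_le _ _) (hb j)
      · rw [Function.update_of_ne hj]
        exact hb j
    obtain ⟨F, hF0, hF1, hF2⟩ := ih (Function.update a i (a i - 1)) (hlt a ha) (D.g i * γ) hsum
    refine ⟨F ∘ₗ hit (f i γ), fun h hh' => hF0 _ (h₁ i γ h hh'), ?_, fun b hb γ' hne => ?_⟩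
    · obtain ⟨r, hr, h⟩ := hf.hit_monomial hh hl (hmem i) a γ γ
      rw [LinearMap.comp_apply, h, map_smul, smul_eq_mul]
      refine mul_ne_zero (mul_ne_zero (mul_ne_zero hr ?_) fun h0 => ?_) hF1
      · rw [if_pos rfl, if_neg, zero_sub]
        · exact neg_ne_zero.mpr one_ne_zero
        · intro h1
          exact D.g_ne_one hh i (inv_eq_one.mp (mul_eq_right.mp h1.symm))
      · have h1 := mul_geom_sum (D.χ i (D.g i) : k) (a i)
        rw [h0, mul_zero, eq_comm, sub_eq_zero] at h1
        exact (D.primitive_of_h_eq_one hh i).pow_ne_one_of_pos_of_lt hi.ne' (ha i) h1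
    · obtain ⟨r, hr, h⟩ := hf.hit_monomial hh hl (hmem i) b γ' γ
      rw [LinearMap.comp_apply, h, map_smul, smul_eq_mul]
      rcases Nat.eq_zero_or_pos (b i) with h0 | h0
      · rw [h0, Finset.sum_range_zero, mul_zero, zero_mul]
      · rw [hF2 _ (hlt b hb), mul_zero]
        rintro ⟨h1, h2⟩
        refine hne ⟨funext fun j => ?_, mul_left_cancel h2⟩
        have h3 := congrFun h1 j
        by_cases hj : j = i
        · subst hj
          rw [Function.update_self, Function.update_self] at h3
          omega
        · rwa [Function.update_of_ne hj, Function.update_of_ne hj] at h3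

/-- A subspace killed by the functionals of degree zero and stable under the operators attached to
the functionals of degree one is zero. This is the form in which the theorem of Heyneman and Radford
on coideals of pointed coalgebras is needed. -/
theorem eq_zero_of_mem [Finite ι] (hf : IsTestFamily D f₀ f) (hh : ∀ i, D.h i = 1)
    {I : Submodule k D.Alg}
    (h₀ : ∀ δ, ∀ h ∈ I, f₀ δ h = 0) (h₁ : ∀ i δ, ∀ h ∈ I, hit (f i δ) h ∈ I)
    {h : D.Alg} (hI : h ∈ I) : h = 0 := by
  have := Fintype.ofFinite ι
  have hl : (Finset.univ : Finset ι).toList.Nodup := Finset.nodup_toList _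
  have hmem : ∀ i : ι, i ∈ (Finset.univ : Finset ι).toList := by simp
  have htop : h ∈ (⊤ : Submodule k D.Alg) := trivial
  rw [← D.span_monomial_eq_top hl hmem, Finsupp.mem_span_range_iff_exists_finsupp] at htop
  obtain ⟨c, rfl⟩ := htop
  suffices hc : c = 0 by rw [hc, Finsupp.sum_zero_index]
  ext p
  obtain ⟨F, hF0, hF1, hF2⟩ := hf.exists_dual hh h₀ h₁ hl hmem p.1.1 p.1.2 p.2
  have h2 := hF0 _ hI
  rw [Finsupp.sum, map_sum, Finset.sum_eq_single p] at h2
  · rw [map_smul, smul_eq_mul] at h2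
    exact (mul_eq_zero.mp h2).resolve_right hF1
  · intro p' _ hp'
    rw [map_smul, hF2 _ p'.1.2, smul_zero]
    rintro ⟨h3, h4⟩
    exact hp' (Prod.ext (Subtype.ext h3) h4)
  · intro hp
    rw [Finsupp.notMem_support_iff.mp hp, zero_smul, map_zero]

end IsTestFamily

end TestFunctionals

end SkewDatum

/-! ### A field of rational functions on which the Hopf algebra acts -/

namespace SkewDatum

variable {k : Type u} [Field k] {G : Type v} [CommGroup G] {ι : Type w}

/-- The conditions under which the Hopf algebra acts inner faithfully on a field. The normalisation
`h i = 1` makes every `x i` a `(g i, 1)`-primitive element. -/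
structure IsRealizable (D : SkewDatum k G ι) : Prop where
  h_eq_one : ∀ i, D.h i = 1
  g_pow : ∀ i, D.g i ^ D.N i = 1
  comm : ∀ i j, i ≠ j → D.c i j = 1 ∨ D.g i * D.g j = 1

theorem χ_g_eq (D : SkewDatum k G ι) (hh : ∀ i, D.h i = 1) {i j : ι} (hij : i ≠ j) :
    D.χ j (D.g i) = D.c i j := by
  rw [D.compat_left i j hij, hh, map_one, mul_one]

theorem c_mul_χ_g (D : SkewDatum k G ι) (hh : ∀ i, D.h i = 1) {i j : ι} (hij : i ≠ j) :
    D.c i j * D.χ i (D.g j) = 1 := by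
  rw [← D.compat_right i j hij, hh, map_one]

/-- The polynomial ring in one variable for each `x i` and one for each element of the group. -/
abbrev Poly (_ : SkewDatum k G ι) : Type (max u v w) := MvPolynomial (ι ⊕ G) k

variable (D : SkewDatum k G ι)

/-- The action of the group on the polynomials: the variable of `x i` has weight `χ i`, and the
variables attached to the elements of the group are translated. -/
noncomputable def translPoly (γ : G) : D.Poly →ₐ[k] D.Poly :=
  MvPolynomial.aeval fun s => Sum.elim
    (fun i => MvPolynomial.C (D.χ i γ : k) * MvPolynomial.X (Sum.inl i))
    (fun δ => MvPolynomial.X (Sum.inr (γ * δ))) s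

@[simp] theorem translPoly_X_inl (γ : G) (i : ι) : D.translPoly γ (MvPolynomial.X (Sum.inl i))
    = MvPolynomial.C (D.χ i γ : k) * MvPolynomial.X (Sum.inl i) := by
  simp [translPoly]

@[simp] theorem translPoly_X_inr (γ δ : G) : D.translPoly γ (MvPolynomial.X (Sum.inr δ))
    = MvPolynomial.X (Sum.inr (γ * δ)) := by
  simp [translPoly]

theorem translPoly_one : D.translPoly 1 = AlgHom.id k D.Poly := by
  refine MvPolynomial.algHom_ext fun s => ?_
  obtain i | δ := s <;> simp

theorem translPoly_mul (γ δ : G) :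
    D.translPoly (γ * δ) = (D.translPoly γ).comp (D.translPoly δ) := by
  refine MvPolynomial.algHom_ext fun s => ?_
  obtain i | ε := s
  · simp only [AlgHom.comp_apply, translPoly_X_inl, map_mul, MvPolynomial.algHom_C,
      MvPolynomial.algebraMap_eq, Units.val_mul]
    ring
  · simp [mul_assoc]

theorem translPoly_injective (γ : G) : Function.Injective (D.translPoly γ) := by
  refine Function.LeftInverse.injective (g := D.translPoly γ⁻¹) fun p => ?_
  rw [← AlgHom.comp_apply, ← translPoly_mul, inv_mul_cancel, translPoly_one, AlgHom.id_apply]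

theorem constantCoeff_translPoly (γ : G) (p : D.Poly) :
    MvPolynomial.constantCoeff (D.translPoly γ p) = MvPolynomial.constantCoeff p := by
  induction p using MvPolynomial.induction_on with
  | C a => rw [MvPolynomial.algHom_C, MvPolynomial.algebraMap_eq]
  | add p q hp hq => rw [map_add, map_add, hp, hq, map_add]
  | mul_X p s hp => obtain i | δ := s <;> simp [hp]

theorem coeff_inr_translPoly (γ δ : G) (p : D.Poly) :
    MvPolynomial.coeff (Finsupp.single (Sum.inr δ) 1) (D.translPoly γ p)
      = MvPolynomial.coeff (Finsupp.single (Sum.inr (γ⁻¹ * δ)) 1) p := by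
  classical
  induction p using MvPolynomial.induction_on with
  | C a =>
    rw [MvPolynomial.algHom_C, MvPolynomial.algebraMap_eq, MvPolynomial.coeff_C,
      MvPolynomial.coeff_C, if_neg, if_neg]
    · exact fun h => one_ne_zero (Finsupp.single_eq_zero.mp h.symm)
    · exact fun h => one_ne_zero (Finsupp.single_eq_zero.mp h.symm)
  | add p q hp hq => rw [map_add, MvPolynomial.coeff_add, hp, hq, MvPolynomial.coeff_add]
  | mul_X p s hp =>
    obtain i | ε := s
    · rw [map_mul, translPoly_X_inl, mul_left_comm, MvPolynomial.coeff_C_mul,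
        MvPolynomial.coeff_mul_X', MvPolynomial.coeff_mul_X', if_neg, if_neg, mul_zero]
      · simp [Finsupp.support_single]
      · simp [Finsupp.support_single]
    · rw [map_mul, translPoly_X_inr, MvPolynomial.coeff_mul_X', MvPolynomial.coeff_mul_X',
        Finsupp.support_single _ one_ne_zero, Finsupp.support_single _ one_ne_zero]
      by_cases h : ε = γ⁻¹ * δ
      · subst h
        have h1 := D.constantCoeff_translPoly γ p
        rw [MvPolynomial.constantCoeff_eq] at h1
        simpa using h1
      · rw [if_neg, if_neg]
        · simpa using h
        · simp only [Finset.mem_singleton, Sum.inr.injEq]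
          rintro rfl
          simp at h

variable {D}

/-- The field of rational functions in one variable for each `x i` and one for each element of
the group. The proof of realizability is an argument so that the action can be an instance. -/
def RatField (_ : D.IsRealizable) : Type (max u v w) := FractionRing (Poly D)

variable (hD : D.IsRealizable)

noncomputable instance : Field (RatField hD) := inferInstanceAs (Field (FractionRing D.Poly))

noncomputable instance : Algebra k (RatField hD) :=
  inferInstanceAs (Algebra k (FractionRing D.Poly))

noncomputable instance : Algebra D.Poly (RatField hD) :=
  inferInstanceAs (Algebra D.Poly (FractionRing D.Poly))

instance : IsScalarTower k D.Poly (RatField hD) :=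
  inferInstanceAs (IsScalarTower k D.Poly (FractionRing D.Poly))

instance : IsFractionRing D.Poly (RatField hD) :=
  inferInstanceAs (IsFractionRing D.Poly (FractionRing D.Poly))

theorem toAlgHom_comp_translPoly_injective (γ : G) : Function.Injective
    ((IsScalarTower.toAlgHom k D.Poly (RatField hD)).comp (D.translPoly γ)) :=
  (IsFractionRing.injective D.Poly (RatField hD)).comp (D.translPoly_injective γ)

/-- The action of the group on the rational functions. -/
noncomputable def transl (γ : G) : RatField hD →ₐ[k] RatField hD :=
  IsFractionRing.liftAlgHom
    (g := (IsScalarTower.toAlgHom k D.Poly (RatField hD)).comp (D.translPoly γ))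
    (toAlgHom_comp_translPoly_injective hD γ)

@[simp] theorem transl_algebraMap (γ : G) (p : D.Poly) :
    transl hD γ (algebraMap D.Poly (RatField hD) p)
      = algebraMap D.Poly (RatField hD) (D.translPoly γ p) := by
  rw [transl, IsFractionRing.liftAlgHom_apply]
  exact IsFractionRing.lift_algebraMap _ p

theorem ratField_algHom_ext {f f' : RatField hD →ₐ[k] RatField hD}
    (h : ∀ p : D.Poly, f (algebraMap D.Poly (RatField hD) p)
      = f' (algebraMap D.Poly (RatField hD) p)) : f = f' := by
  refine AlgHom.coe_ringHom_injective (IsLocalization.ringHom_ext (nonZeroDivisors D.Poly) ?_)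
  exact RingHom.ext h

/-- The action of the group on the rational functions, as a homomorphism. -/
noncomputable def translHom : G →* Module.End k (RatField hD) where
  toFun γ := (transl hD γ).toLinearMap
  map_one' := by
    have h : transl hD 1 = AlgHom.id k (RatField hD) :=
      ratField_algHom_ext hD fun p => by
        rw [transl_algebraMap, translPoly_one]; rfl
    rw [h]
    rfl
  map_mul' γ δ := by
    have h : transl hD (γ * δ) = (transl hD γ).comp (transl hD δ) :=
      ratField_algHom_ext hD fun p => by
        rw [AlgHom.comp_apply, transl_algebraMap, transl_algebraMap, transl_algebraMap,
          translPoly_mul]; rfl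
    rw [h]
    rfl

theorem translHom_apply (γ : G) (l : RatField hD) : translHom hD γ l = transl hD γ l := rfl

/-- The rational function by which the action of `x i` is twisted. -/
noncomputable def weightVar (i : ι) : RatField hD :=
  algebraMap D.Poly (RatField hD) (MvPolynomial.X (Sum.inl i))

theorem transl_weightVar (γ : G) (i : ι) :
    transl hD γ (weightVar hD i) = algebraMap k (RatField hD) (D.χ i γ) * weightVar hD i := by
  rw [weightVar, transl_algebraMap, translPoly_X_inl, map_mul, ← MvPolynomial.algebraMap_eq,
    ← IsScalarTower.algebraMap_apply]

/-- The representation on rational functions: `x i` acts by `b ↦ X i * (g i b - b)`. -/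
noncomputable def ratAction : D.Alg →ₐ[k] Module.End k (RatField hD) :=
  lift (translHom hD) (fun i => twistedDiff (weightVar hD i) (translHom hD (D.g i)))
    (by
      intro γ i
      ext b
      simp only [Module.End.mul_apply, LinearMap.smul_apply, twistedDiff_apply]
      rw [← Module.End.mul_apply (translHom hD (D.g i)), ← map_mul, mul_comm (D.g i),
        map_mul (translHom hD),
        Module.End.mul_apply, translHom_apply, map_mul (transl hD γ), transl_weightVar,
        map_sub, Algebra.smul_def, mul_assoc]
      rfl)
    (by
      intro i
      ext b
      obtain ⟨c, -, h⟩ := twistedDiff_pow_primitive (τ := translHom hD (D.g i))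
        (map_mul (transl hD (D.g i)))
        (transl_weightVar hD (D.g i) i) (D.primitive_of_h_eq_one hD.h_eq_one i) (D.N_pos i)
      rw [h, ← map_pow, hD.g_pow, map_one]
      simp)
    (by
      intro i j hij
      ext b
      have h := twistedDiff_mul_sub (τ₁ := translHom hD (D.g i)) (τ₂ := translHom hD (D.g j))
        (map_mul (transl hD (D.g i))) (map_mul (transl hD (D.g j)))
        (by rw [← map_mul, mul_comm, map_mul])
        (transl_weightVar hD (D.g i) j) (transl_weightVar hD (D.g j) i)
        (by rw [← Units.val_mul, D.χ_g_eq hD.h_eq_one hij, D.c_mul_χ_g hD.h_eq_one hij,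
          Units.val_one]) b
      rw [D.χ_g_eq hD.h_eq_one hij] at h
      refine sub_eq_zero.mp (h.trans ?_)
      rcases hD.comm i j hij with h1 | h1
      · rw [h1, Units.val_one, sub_self, map_zero, zero_mul, zero_mul]
      · rw [← Module.End.mul_apply, ← map_mul, h1, map_one, Module.End.one_apply, sub_self,
          mul_zero])

noncomputable instance : Module D.Alg (RatField hD) :=
  Module.compHom (RatField hD) (ratAction hD).toRingHom

theorem smul_ratField (h : D.Alg) (l : RatField hD) : h • l = ratAction hD h l := rfl

instance : IsScalarTower k D.Alg (RatField hD) :=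
  ⟨fun r h l => by rw [smul_ratField, smul_ratField, map_smul, LinearMap.smul_apply]⟩

theorem of_smul_ratField (γ : G) (l : RatField hD) : D.of γ • l = transl hD γ l := by
  rw [smul_ratField, ratAction, lift_of, translHom_apply]

theorem x_smul_ratField (i : ι) (l : RatField hD) :
    D.x i • l = weightVar hD i * (transl hD (D.g i) l - l) := by
  rw [smul_ratField, ratAction, lift_x, twistedDiff_apply, translHom_apply]

theorem of_smul_algebraMap (γ : G) (p : D.Poly) :
    D.of γ • algebraMap D.Poly (RatField hD) p
      = algebraMap D.Poly (RatField hD) (D.translPoly γ p) := by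
  rw [of_smul_ratField, transl_algebraMap]

theorem x_smul_algebraMap (i : ι) (p : D.Poly) :
    D.x i • algebraMap D.Poly (RatField hD) p = algebraMap D.Poly (RatField hD)
      (MvPolynomial.X (Sum.inl i) * (D.translPoly (D.g i) p - p)) := by
  rw [x_smul_ratField, transl_algebraMap, map_mul, map_sub, weightVar]

theorem exists_smul_algebraMap (h : D.Alg) (p : D.Poly) : ∃ q : D.Poly,
    h • algebraMap D.Poly (RatField hD) p = algebraMap D.Poly (RatField hD) q := by
  induction h using alg_induction generalizing p with
  | hk r => exact ⟨r • p, by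
      rw [algebraMap_smul]
      exact (map_smul (IsScalarTower.toAlgHom k D.Poly (RatField hD)) r p).symm⟩
  | hof γ => exact ⟨_, of_smul_algebraMap hD γ p⟩
  | hx i => exact ⟨_, x_smul_algebraMap hD i p⟩
  | hmul a b ha hb =>
    obtain ⟨q, hq⟩ := hb p
    obtain ⟨q', hq'⟩ := ha q
    exact ⟨q', by rw [mul_smul, hq, hq']⟩
  | hadd a b ha hb =>
    obtain ⟨q, hq⟩ := hb p
    obtain ⟨q', hq'⟩ := ha p
    exact ⟨q' + q, by rw [add_smul, hq, hq', map_add]⟩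

/-- The Leibniz rule for a Hopf action has to be checked on algebra generators only. -/
theorem isHopfAction_of_generators {L : Type*} [Field L] [Algebra k L] [Module D.Alg L]
    [IsScalarTower k D.Alg L] (hh : ∀ i, D.h i = 1)
    (hof : ∀ γ (a b : L), D.of γ • (a * b) = (D.of γ • a) * (D.of γ • b))
    (hof1 : ∀ γ, D.of γ • (1 : L) = 1)
    (hx : ∀ i (a b : L), D.x i • (a * b) = (D.of (D.g i) • a) * (D.x i • b) + (D.x i • a) * b)
    (hx1 : ∀ i, D.x i • (1 : L) = 0) : IsHopfAction k D.Alg L := by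
  constructor
  · intro h
    have key : ∀ h : D.Alg, (∀ a b : L, h • (a * b) = LinearMap.mul' k L
          (TensorProduct.map (orbitMap k D.Alg a) (orbitMap k D.Alg b) (Coalgebra.comul h))) →
        ∀ (a b : L) (t : D.Alg ⊗[k] D.Alg),
          h • LinearMap.mul' k L
            (TensorProduct.map (orbitMap k D.Alg a) (orbitMap k D.Alg b) t)
          = LinearMap.mul' k L (TensorProduct.map (orbitMap k D.Alg a) (orbitMap k D.Alg b)
              (Coalgebra.comul h * t)) := by
      intro h hh a b t
      induction t with
      | zero => simp
      | add s t hs ht => rw [map_add, map_add, smul_add, hs, ht, mul_add, map_add, map_add]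
      | tmul c d =>
        have h1 : LinearMap.mul' k L
            (TensorProduct.map (orbitMap k D.Alg a) (orbitMap k D.Alg b) (c ⊗ₜ[k] d))
            = (c • a) * (d • b) := by simp [orbitMap]
        rw [h1, hh]
        generalize Coalgebra.comul (R := k) h = s
        induction s with
        | zero => simp
        | add s s' hs hs' => rw [map_add, map_add, hs, hs', add_mul, map_add, map_add]
        | tmul c' d' => simp [orbitMap, mul_smul]
    induction h using alg_induction with
    | hk r =>
      intro a b
      simp [orbitMap, Algebra.algebraMap_eq_smul_one, Algebra.TensorProduct.one_def]
    | hof γ =>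
      intro a b
      rw [hof, comul_of]
      simp [orbitMap]
    | hx i =>
      intro a b
      rw [hx, comul_x, hh]
      simp [orbitMap]
    | hmul h h' ih ih' =>
      intro a b
      rw [mul_smul, ih', key h ih, ← Bialgebra.comul_mul]
    | hadd h h' ih ih' =>
      intro a b
      rw [add_smul, ih, ih', map_add, map_add, map_add]
  · intro h
    induction h using alg_induction with
    | hk r => simp [Algebra.algebraMap_eq_smul_one]
    | hof γ => rw [hof1, counit_of, map_one]
    | hx i => rw [hx1, counit_x, map_zero]
    | hmul h h' ih ih' =>
      rw [mul_smul, ih', Bialgebra.counit_mul, map_mul, Algebra.algebraMap_eq_smul_one,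
        smul_algebra_smul_comm, ih, ← Algebra.smul_def, Algebra.algebraMap_eq_smul_one, smul_smul,
        mul_comm, ← smul_smul, Algebra.smul_def, Algebra.algebraMap_eq_smul_one]
    | hadd h h' ih ih' => rw [add_smul, ih, ih', map_add, map_add]

instance : IsHopfAction k D.Alg (RatField hD) :=
  isHopfAction_of_generators hD.h_eq_one
    (fun γ a b => by rw [of_smul_ratField, of_smul_ratField, of_smul_ratField, map_mul])
    (fun γ => by rw [of_smul_ratField, map_one])
    (fun i a b => by
      rw [x_smul_ratField, x_smul_ratField, x_smul_ratField, of_smul_ratField, map_mul]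
      ring)
    (fun i => by rw [x_smul_ratField, map_one, sub_self, mul_zero])

/-- Coefficients of `h • X`, where `X` is the variable of the identity element of the group, supply
functionals that detect monomials of degree at most one. -/
theorem exists_isTestFamily [DecidableEq ι] [DecidableEq G] :
    ∃ (f₀ : G → D.Alg →ₗ[k] k) (f : ι → G → D.Alg →ₗ[k] k), IsTestFamily D f₀ f ∧
      ∀ h : D.Alg, (∀ l : RatField hD, h • l = 0) →
        (∀ δ, f₀ δ h = 0) ∧ ∀ i δ, f i δ h = 0 := by
  classical
  obtain ⟨s, hs⟩ := LinearMap.exists_leftInverse_of_injective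
    (IsScalarTower.toAlgHom k D.Poly (RatField hD)).toLinearMap
    (LinearMap.ker_eq_bot.mpr (IsFractionRing.injective D.Poly (RatField hD)))
  have hs' : ∀ p, s (algebraMap D.Poly (RatField hD) p) = p := LinearMap.congr_fun hs
  let e : RatField hD := algebraMap D.Poly (RatField hD) (MvPolynomial.X (Sum.inr 1))
  let F : (ι ⊕ G →₀ ℕ) → D.Alg →ₗ[k] k := fun m =>
    MvPolynomial.lcoeff k m ∘ₗ s ∘ₗ orbitMap k D.Alg e
  have hF : ∀ m h, F m h = MvPolynomial.coeff m (s (h • e)) := fun m h => rfl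
  have hFof : ∀ m γ, F m (D.of γ) = MvPolynomial.coeff m (MvPolynomial.X (Sum.inr γ)) := by
    intro m γ
    rw [hF, of_smul_algebraMap, hs', translPoly_X_inr, mul_one]
  have hFx : ∀ m j h, ∃ q : D.Poly, (∀ m', F m' h = MvPolynomial.coeff m' q) ∧
      F m (D.x j * h) = MvPolynomial.coeff m
        (MvPolynomial.X (Sum.inl j) * (D.translPoly (D.g j) q - q)) := by
    intro m j h
    obtain ⟨q, hq⟩ := exists_smul_algebraMap hD h (MvPolynomial.X (Sum.inr 1))
    refine ⟨q, fun m' => ?_, ?_⟩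
    · rw [hF, hq, hs']
    · rw [hF, mul_smul, hq, x_smul_algebraMap, hs']
  refine ⟨fun δ => F (Finsupp.single (Sum.inr δ) 1), fun i δ =>
    F (Finsupp.single (Sum.inl i) 1 + Finsupp.single (Sum.inr δ) 1), ⟨?_, ?_, ?_, ?_, ?_⟩, ?_⟩
  · intro γ δ
    rw [hFof, MvPolynomial.coeff_X]
    congr 1
    rw [Finsupp.single_left_inj one_ne_zero]
    simp
  · intro δ j h
    obtain ⟨q, -, h2⟩ := hFx (Finsupp.single (Sum.inr δ) 1) j h
    rw [h2, MvPolynomial.coeff_X_mul', if_neg]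
    simp [Finsupp.support_single]
  · intro i γ δ
    rw [hFof, MvPolynomial.coeff_X, if_neg]
    intro h
    have := DFunLike.congr_fun h (Sum.inl i)
    simp at this
  · intro i δ h
    obtain ⟨q, h1, h2⟩ := hFx (Finsupp.single (Sum.inl i) 1 + Finsupp.single (Sum.inr δ) 1) i h
    rw [h2, MvPolynomial.coeff_X_mul, MvPolynomial.coeff_sub, coeff_inr_translPoly, h1, h1]
  · intro i j δ h hij
    obtain ⟨q, -, h2⟩ := hFx (Finsupp.single (Sum.inl i) 1 + Finsupp.single (Sum.inr δ) 1) j h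
    rw [h2, MvPolynomial.coeff_X_mul', if_neg]
    simp [Ne.symm hij]
  · intro h hh
    refine ⟨fun δ => ?_, fun i δ => ?_⟩
    · rw [hF, hh, map_zero, MvPolynomial.coeff_zero]
    · rw [hF, hh, map_zero, MvPolynomial.coeff_zero]

theorem isInnerFaithful_ratField [Finite ι] :
    IsInnerFaithful k D.Alg (RatField hD) := by
  classical
  intro I _ hI hbot
  by_contra! hkill
  obtain ⟨f₀, f, hf, hzero⟩ := exists_isTestFamily hD
  refine hbot ((Submodule.eq_bot_iff _).mpr fun h hh =>
    hf.eq_zero_of_mem hD.h_eq_one (I := I.restrictScalars k)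
      (fun δ h hh => (hzero h (hkill h hh)).1 δ) (fun i δ h hh => ?_) hh)
  have hle : I.restrictScalars k ≤ LinearMap.ker (f i δ) := fun h hh =>
    (hzero h (hkill h hh)).2 i δ
  rw [← Submodule.Quotient.mk_eq_zero]
  have key : ∀ t : D.Alg ⊗[k] D.Alg,
      (I.restrictScalars k).mkQ (TensorProduct.rid k D.Alg ((f i δ).lTensor D.Alg t))
        = TensorProduct.rid k _ (((I.restrictScalars k).liftQ (f i δ) hle).lTensor _
          (TensorProduct.map (I.restrictScalars k).mkQ (I.restrictScalars k).mkQ t)) := by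
    intro t
    induction t with
    | zero => simp
    | tmul a b => simp
    | add s t hs ht => simp only [map_add, hs, ht]
  refine (key _).trans ?_
  rw [hI.map_mkQ_comul_eq_zero hh, map_zero, map_zero]

theorem IsRealizable.isGaloisTheoretical (hD : D.IsRealizable) [Finite ι] :
    IsGaloisTheoretical k D.Alg :=
  ⟨RatField hD, inferInstance, inferInstance, inferInstance, inferInstance,
    inferInstance, isInnerFaithful_ratField hD⟩

/-- A homomorphism between presented Hopf algebras which embeds the groups and the generators is
injective, as the target supplies enough test functionals. -/
theorem IsRealizable.injective_of_embedding (hD : D.IsRealizable) {G' : Type*}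
    [CommGroup G'] {ι' : Type*} [Finite ι']
    {D' : SkewDatum k G' ι'} (hh : ∀ i, D'.h i = 1) (φ : D'.Alg →ₐc[k] D.Alg) {j : G' →* G}
    {e : ι' → ι} (hj : Function.Injective j) (he : Function.Injective e)
    (hof : ∀ γ, φ (D'.of γ) = D.of (j γ)) (hx : ∀ i, φ (D'.x i) = D.x (e i))
    (hg : ∀ i, j (D'.g i) = D.g (e i)) : Function.Injective φ := by
  classical
  obtain ⟨f₀, f, hf, -⟩ := exists_isTestFamily hD
  have hφ : IsTestFamily D' (fun δ => f₀ (j δ) ∘ₗ (φ : D'.Alg →ₗ[k] D.Alg))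
      (fun i δ => f (e i) (j δ) ∘ₗ (φ : D'.Alg →ₗ[k] D.Alg)) := by
    refine ⟨fun γ δ => ?_, fun δ i h => ?_, fun i γ δ => ?_, fun i δ h => ?_,
      fun i i' δ h hii' => ?_⟩
    · simp [hof, hf.zero_of, hj.eq_iff]
    · simp [hx, hf.zero_x]
    · simp [hof, hf.of]
    · simp [hx, hf.x_self, hg]
    · simp [hx, hf.x_ne _ _ _ _ (he.ne hii')]
  have hhit : ∀ (F : D.Alg →ₗ[k] k) (h : D'.Alg),
      φ (hit (F ∘ₗ (φ : D'.Alg →ₗ[k] D.Alg)) h) = hit F (φ h) := by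
    intro F h
    have key : ∀ t : D'.Alg ⊗[k] D'.Alg,
        φ (TensorProduct.rid k _ ((F ∘ₗ (φ : D'.Alg →ₗ[k] D.Alg)).lTensor _ t))
          = TensorProduct.rid k _ (F.lTensor _
            (TensorProduct.map (φ : D'.Alg →ₗ[k] D.Alg) (φ : D'.Alg →ₗ[k] D.Alg) t)) := by
      intro t
      induction t with
      | zero => simp
      | tmul a b => simp
      | add s t hs ht => simp only [map_add, hs, ht]
    refine (key _).trans ?_
    rw [CoalgHomClass.map_comp_comul_apply]
    rfl
  refine (injective_iff_map_eq_zero φ).mpr fun h h0 =>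
    hφ.eq_zero_of_mem hh (I := LinearMap.ker (φ : D'.Alg →ₗ[k] D.Alg)) (fun δ h h0 => ?_)
      (fun i δ h h0 => ?_) h0
  · have h1 : φ h = 0 := h0
    simp [h1]
  · have h1 : φ h = 0 := h0
    refine (hhit _ _).trans ?_
    rw [h1, map_zero]

end SkewDatum

/-! ### Tensor products and normalisation of presented Hopf algebras -/

namespace SkewDatum

section Prod

variable {k : Type u} [Field k] {G₁ G₂ : Type*} [CommGroup G₁] [CommGroup G₂] {ι₁ ι₂ : Type*}

/-- The datum presenting the tensor product of two presented Hopf algebras: each group acts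
trivially on the generators of the other algebra, and the generators commute. -/
def prod (D₁ : SkewDatum k G₁ ι₁) (D₂ : SkewDatum k G₂ ι₂) : SkewDatum k (G₁ × G₂) (ι₁ ⊕ ι₂) where
  g := Sum.elim (fun i => (D₁.g i, 1)) (fun i => (1, D₂.g i))
  h := Sum.elim (fun i => (D₁.h i, 1)) (fun i => (1, D₂.h i))
  χ := Sum.elim (fun i => (D₁.χ i).comp (MonoidHom.fst G₁ G₂))
    (fun i => (D₂.χ i).comp (MonoidHom.snd G₁ G₂))
  N := Sum.elim D₁.N D₂.N
  c := Sum.elim (fun i => Sum.elim (D₁.c i) fun _ => 1) (fun i => Sum.elim (fun _ => 1) (D₂.c i))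
  two_le := by rintro (i | i) <;> simp [two_le]
  primitive := by rintro (i | i) <;> simp [primitive]
  compat_left := by
    rintro (i | i) (j | j) hij
    · simpa using D₁.compat_left i j (by simpa using hij)
    · simp
    · simp
    · simpa using D₂.compat_left i j (by simpa using hij)
  compat_right := by
    rintro (i | i) (j | j) hij
    · simpa using D₁.compat_right i j (by simpa using hij)
    · simp
    · simp
    · simpa using D₂.compat_right i j (by simpa using hij)

variable (D₁ : SkewDatum k G₁ ι₁) (D₂ : SkewDatum k G₂ ι₂)

@[simp] theorem prod_g_inl (i : ι₁) : (D₁.prod D₂).g (Sum.inl i) = (D₁.g i, 1) := rfl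

@[simp] theorem prod_g_inr (i : ι₂) : (D₁.prod D₂).g (Sum.inr i) = (1, D₂.g i) := rfl

@[simp] theorem prod_h_inl (i : ι₁) : (D₁.prod D₂).h (Sum.inl i) = (D₁.h i, 1) := rfl

@[simp] theorem prod_h_inr (i : ι₂) : (D₁.prod D₂).h (Sum.inr i) = (1, D₂.h i) := rfl

@[simp] theorem prod_χ_inl (i : ι₁) (a : G₁ × G₂) :
    (D₁.prod D₂).χ (Sum.inl i) a = D₁.χ i a.1 := rfl

@[simp] theorem prod_χ_inr (i : ι₂) (a : G₁ × G₂) :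
    (D₁.prod D₂).χ (Sum.inr i) a = D₂.χ i a.2 := rfl

theorem prod_c_inl_inr (i : ι₁) (j : ι₂) : (D₁.prod D₂).c (Sum.inl i) (Sum.inr j) = 1 := rfl

/-- The pairs of group elements inside the tensor product. -/
noncomputable def prodOf : G₁ × G₂ →* D₁.Alg ⊗[k] D₂.Alg where
  toFun a := D₁.of a.1 ⊗ₜ[k] D₂.of a.2
  map_one' := by simp [Algebra.TensorProduct.one_def]
  map_mul' := by simp

theorem prodOf_apply (a : G₁ × G₂) : prodOf D₁ D₂ a = D₁.of a.1 ⊗ₜ[k] D₂.of a.2 := rfl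

/-- The comparison map from the algebra presented by the product datum to the tensor product. -/
noncomputable def prodHom : (D₁.prod D₂).Alg →ₐ[k] D₁.Alg ⊗[k] D₂.Alg :=
  lift (prodOf D₁ D₂)
    (Sum.elim (fun i => D₁.x i ⊗ₜ[k] 1) (fun i => 1 ⊗ₜ[k] D₂.x i))
    (by
      rintro a (i | i) <;>
      simp [prodOf_apply, prod, of_mul_x, TensorProduct.smul_tmul'])
    (by
      rintro (i | i) <;>
      simp [prod, Algebra.TensorProduct.tmul_pow, x_pow])
    (by
      rintro (i | i) (j | j) hij
      · simp [prod, D₁.x_mul_x (i := i) (j := j) (by simpa using hij), TensorProduct.smul_tmul']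
      · simp [prod]
      · simp [prod]
      · simp [prod, D₂.x_mul_x (i := i) (j := j) (by simpa using hij)])

@[simp] theorem prodHom_of (a : G₁ × G₂) :
    prodHom D₁ D₂ ((D₁.prod D₂).of a) = D₁.of a.1 ⊗ₜ[k] D₂.of a.2 := by
  simp [prodHom, prodOf_apply]

@[simp] theorem prodHom_x_inl (i : ι₁) :
    prodHom D₁ D₂ ((D₁.prod D₂).x (Sum.inl i)) = D₁.x i ⊗ₜ[k] 1 := by simp [prodHom]

@[simp] theorem prodHom_x_inr (i : ι₂) :
    prodHom D₁ D₂ ((D₁.prod D₂).x (Sum.inr i)) = 1 ⊗ₜ[k] D₂.x i := by simp [prodHom]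

/-- The first factor of the product. -/
noncomputable def prodInl : D₁.Alg →ₐ[k] (D₁.prod D₂).Alg :=
  lift ((D₁.prod D₂).of.comp (MonoidHom.inl G₁ G₂)) (fun i => (D₁.prod D₂).x (Sum.inl i))
    (fun a i => (D₁.prod D₂).of_mul_x (a, 1) (Sum.inl i))
    (fun i => (D₁.prod D₂).x_pow (Sum.inl i))
    (fun i j hij => (D₁.prod D₂).x_mul_x (i := Sum.inl i) (j := Sum.inl j) (by simpa using hij))

/-- The second factor of the product. -/
noncomputable def prodInr : D₂.Alg →ₐ[k] (D₁.prod D₂).Alg :=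
  lift ((D₁.prod D₂).of.comp (MonoidHom.inr G₁ G₂)) (fun i => (D₁.prod D₂).x (Sum.inr i))
    (fun a i => (D₁.prod D₂).of_mul_x (1, a) (Sum.inr i))
    (fun i => (D₁.prod D₂).x_pow (Sum.inr i))
    (fun i j hij => (D₁.prod D₂).x_mul_x (i := Sum.inr i) (j := Sum.inr j) (by simpa using hij))

@[simp] theorem prodInl_of (a : G₁) : prodInl D₁ D₂ (D₁.of a) = (D₁.prod D₂).of (a, 1) :=
  lift_of _ _ _ _ _ a

@[simp] theorem prodInl_x (i : ι₁) : prodInl D₁ D₂ (D₁.x i) = (D₁.prod D₂).x (Sum.inl i) :=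
  lift_x _ _ _ _ _ i

@[simp] theorem prodInr_of (a : G₂) : prodInr D₁ D₂ (D₂.of a) = (D₁.prod D₂).of (1, a) :=
  lift_of _ _ _ _ _ a

@[simp] theorem prodInr_x (i : ι₂) : prodInr D₁ D₂ (D₂.x i) = (D₁.prod D₂).x (Sum.inr i) :=
  lift_x _ _ _ _ _ i

/-- An element commuting with the generators commutes with everything. -/
theorem commute_of_generators {k : Type u} [Field k] {G : Type*} [CommGroup G] {ι : Type*}
    {D : SkewDatum k G ι} {A : Type*} [Ring A] [Algebra k A] (φ : D.Alg →ₐ[k] A) (b : A)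
    (hof : ∀ a, Commute (φ (D.of a)) b) (hx : ∀ i, Commute (φ (D.x i)) b) (h : D.Alg) :
    Commute (φ h) b := by
  induction h using alg_induction with
  | hk r => rw [AlgHom.commutes]; exact Algebra.commute_algebraMap_left r b
  | hof a => exact hof a
  | hx i => exact hx i
  | hmul a b ha hb => rw [map_mul]; exact ha.mul_left hb
  | hadd a b ha hb => rw [map_add]; exact ha.add_left hb

theorem commute_prodInl_prodInr (a : D₁.Alg) (b : D₂.Alg) :
    Commute (prodInl D₁ D₂ a) (prodInr D₁ D₂ b) := by
  refine commute_of_generators _ _ (fun a => ?_) (fun i => ?_) a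
  · refine (commute_of_generators _ _ (fun b => ?_) (fun j => ?_) b).symm
    · rw [prodInl_of, prodInr_of, Commute, SemiconjBy, ← map_mul, ← map_mul, mul_comm]
    · rw [prodInl_of, prodInr_x, Commute, SemiconjBy, of_mul_x, prod_χ_inr, map_one,
        Units.val_one, one_smul]
  · refine (commute_of_generators _ _ (fun b => ?_) (fun j => ?_) b).symm
    · rw [prodInl_x, prodInr_of, Commute, SemiconjBy, of_mul_x, prod_χ_inl, map_one,
        Units.val_one, one_smul]
    · refine Commute.symm ?_
      rw [prodInl_x, prodInr_x, Commute, SemiconjBy,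
        x_mul_x _ (i := Sum.inl i) (j := Sum.inr j) (by simp), prod_c_inl_inr, Units.val_one,
        one_smul]

theorem prodHom_comp_lift : (prodHom D₁ D₂).comp
    (Algebra.TensorProduct.lift (prodInl D₁ D₂) (prodInr D₁ D₂) (commute_prodInl_prodInr D₁ D₂))
      = AlgHom.id k _ := by
  refine Algebra.TensorProduct.ext (hom_ext (fun a => ?_) fun i => ?_)
    (hom_ext (fun a => ?_) fun i => ?_) <;> simp

theorem lift_comp_prodHom :
    (Algebra.TensorProduct.lift (prodInl D₁ D₂) (prodInr D₁ D₂)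
      (commute_prodInl_prodInr D₁ D₂)).comp (prodHom D₁ D₂) = AlgHom.id k _ := by
  refine hom_ext (fun a => ?_) ?_
  · rw [AlgHom.comp_apply, prodHom_of, Algebra.TensorProduct.lift_tmul, prodInl_of, prodInr_of,
      ← map_mul]
    simp
  · rintro (i | i) <;> simp

theorem prodHom_bijective : Function.Bijective (prodHom D₁ D₂) :=
  Function.bijective_iff_has_inverse.mpr ⟨_, DFunLike.congr_fun (lift_comp_prodHom D₁ D₂),
    DFunLike.congr_fun (prodHom_comp_lift D₁ D₂)⟩

/-- The comparison map as a homomorphism of bialgebras. -/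
noncomputable def prodBialgHom : (D₁.prod D₂).Alg →ₐc[k] D₁.Alg ⊗[k] D₂.Alg :=
  BialgHom.ofAlgHom (prodHom D₁ D₂)
    (by
      refine hom_ext (fun a => ?_) ?_
      · simp
      · rintro (i | i) <;> simp)
    (by
      refine hom_ext (fun a => ?_) ?_
      · simp
      · rintro (i | i) <;>
        simp [TensorProduct.add_tmul, TensorProduct.tmul_add, Algebra.TensorProduct.one_def])

/-- The tensor product of two presented Hopf algebras is presented by the product datum. -/
noncomputable def prodEquiv : D₁.Alg ⊗[k] D₂.Alg ≃ₐc[k] (D₁.prod D₂).Alg :=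
  (BialgEquiv.ofBijective (prodBialgHom D₁ D₂) (prodHom_bijective D₁ D₂)).symm

variable {D₁ D₂}

theorem IsRealizable.prod (h₁ : D₁.IsRealizable) (h₂ : D₂.IsRealizable) :
    (D₁.prod D₂).IsRealizable where
  h_eq_one := by rintro (i | i) <;> simp [SkewDatum.prod, h₁.h_eq_one, h₂.h_eq_one]
  g_pow := by rintro (i | i) <;> simp [SkewDatum.prod, h₁.g_pow, h₂.g_pow]
  comm := by
    rintro (i | i) (j | j) hij
    · simpa [SkewDatum.prod] using h₁.comm i j (by simpa using hij)
    · simp [SkewDatum.prod]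
    · simp [SkewDatum.prod]
    · simpa [SkewDatum.prod] using h₂.comm i j (by simpa using hij)

end Prod

section Normalize

variable {k : Type u} [Field k] {G : Type v} [CommGroup G] {ι : Type w} (D : SkewDatum k G ι)

/-- The datum obtained on replacing each `x i` by the `(g i * (h i)⁻¹, 1)`-primitive element
`x i * (h i)⁻¹`. -/
def normalize : SkewDatum k G ι where
  g i := D.g i * (D.h i)⁻¹
  h _ := 1
  χ := D.χ
  N := D.N
  c i j := (D.χ j (D.h i))⁻¹ * D.c i j * D.χ i (D.h j)
  two_le := D.two_le
  primitive i := by simpa using D.primitive i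
  compat_left i j hij := by
    rw [map_mul, map_inv, D.compat_left i j hij, map_one, mul_one, mul_comm, mul_assoc]
  compat_right i j hij := by
    have h := D.compat_right i j hij
    have key : ∀ a b c : kˣ, 1 = (c * a)⁻¹ * c * b * (a * b⁻¹) := by
      intro a b c
      ext
      push_cast
      field_simp
    rw [map_one, map_mul, map_inv, h]
    exact key _ _ _

@[simp] theorem normalize_g (i : ι) : D.normalize.g i = D.g i * (D.h i)⁻¹ := rfl

@[simp] theorem normalize_h (i : ι) : D.normalize.h i = 1 := rfl

/-- The identification of the normalised algebra with the given one, on algebras. -/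
noncomputable def normalizeHom : D.normalize.Alg →ₐ[k] D.Alg :=
  lift D.of (fun i => D.x i * D.of (D.h i)⁻¹)
    (fun a i => by
      rw [← mul_assoc, of_mul_x, smul_mul_assoc, mul_assoc, mul_assoc, ← map_mul, ← map_mul,
        mul_comm a]
      rfl)
    (fun i => by
      obtain ⟨r, hr⟩ := D.x_of_pow i (D.h i)⁻¹ (D.N i)
      refine hr.trans ?_
      rw [x_pow, zero_mul, smul_zero])
    (fun i j hij => by
      rw [x_of_mul_x_of, x_of_mul_x_of, D.x_mul_x hij, mul_comm (D.h i)⁻¹, smul_mul_assoc,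
        smul_smul, smul_smul]
      congr 1
      simp only [normalize, map_inv, Units.val_mul]
      rw [mul_assoc _ _ (((D.χ i) (D.h j))⁻¹ : kˣ).val, Units.mul_inv, mul_one])

/-- The inverse of the identification of the normalised algebra with the given one. -/
noncomputable def normalizeInv : D.Alg →ₐ[k] D.normalize.Alg :=
  lift D.normalize.of (fun i => D.normalize.x i * D.normalize.of (D.h i))
    (fun a i => by
      rw [← mul_assoc, of_mul_x, smul_mul_assoc, mul_assoc, mul_assoc, ← map_mul, ← map_mul,
        mul_comm a]
      rfl)
    (fun i => by
      obtain ⟨r, hr⟩ := D.normalize.x_of_pow i (D.h i) (D.N i)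
      refine hr.trans ?_
      rw [show D.normalize.x i ^ D.N i = 0 from D.normalize.x_pow i, zero_mul, smul_zero])
    (fun i j hij => by
      rw [x_of_mul_x_of, x_of_mul_x_of, D.normalize.x_mul_x hij, mul_comm (D.h i), smul_mul_assoc,
        smul_smul, smul_smul]
      congr 1
      simp only [normalize, Units.val_mul]
      rw [mul_assoc, Units.mul_inv_cancel_left])

theorem normalizeHom_bijective : Function.Bijective D.normalizeHom := by
  have h₁ : D.normalizeInv.comp D.normalizeHom = AlgHom.id k _ :=
    hom_ext (fun a => by simp [normalizeHom, normalizeInv]) fun i => by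
      simp [normalizeHom, normalizeInv, mul_assoc, of_mul_of_inv]
  have h₂ : D.normalizeHom.comp D.normalizeInv = AlgHom.id k _ :=
    hom_ext (fun a => by simp [normalizeHom, normalizeInv]) fun i => by
      simp [normalizeHom, normalizeInv, mul_assoc, of_inv_mul_of]
  exact Function.bijective_iff_has_inverse.mpr
    ⟨_, DFunLike.congr_fun h₁, DFunLike.congr_fun h₂⟩

/-- The identification of the normalised algebra with the given one, on bialgebras. -/
noncomputable def normalizeBialgHom : D.normalize.Alg →ₐc[k] D.Alg :=
  BialgHom.ofAlgHom D.normalizeHom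
    (hom_ext (fun a => by simp [normalizeHom]) fun i => by
      simp [normalizeHom, Bialgebra.counit_mul])
    (hom_ext (fun a => by simp [normalizeHom]) fun i => by
      simp [normalizeHom, Bialgebra.comul_mul, add_mul, of_mul_of_inv])

/-- Normalising a datum does not change the Hopf algebra which it presents. -/
noncomputable def normalizeEquiv : D.Alg ≃ₐc[k] D.normalize.Alg :=
  (BialgEquiv.ofBijective D.normalizeBialgHom D.normalizeHom_bijective).symm

end Normalize

end SkewDatum

/-! ### Taft, Nichols and book algebras are realizable -/

section Building

variable {k : Type u} [Field k]

theorem cyclicGen_pow (n : ℕ) : cyclicGen n ^ n = 1 := by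
  rw [cyclicGen, ← ofAdd_nsmul]
  simp

theorem isRealizable_taftDatum (n : ℕ) (hn : 2 ≤ n) (ζ : kˣ) (hζ : IsPrimitiveRoot ζ n) :
    (taftDatum n hn ζ hζ).IsRealizable where
  h_eq_one _ := rfl
  g_pow _ := cyclicGen_pow n
  comm i j hij := absurd (Subsingleton.elim i j) hij

theorem isRealizable_nicholsDatum [CharZero k] (n : ℕ) : (nicholsDatum k n).IsRealizable where
  h_eq_one _ := rfl
  g_pow _ := cyclicGen_pow 2
  comm _ _ _ := Or.inr ((pow_two _).symm.trans (cyclicGen_pow 2))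

theorem isRealizable_normalize_bookDatum (n : ℕ) (hn : 2 ≤ n) (ζ : kˣ) (hζ : IsPrimitiveRoot ζ n) :
    (bookDatum n hn ζ hζ).normalize.IsRealizable where
  h_eq_one _ := rfl
  g_pow := fun i => by
    fin_cases i <;> simp [SkewDatum.normalize, bookDatum, cyclicGen_pow]
  comm := by
    intro i j hij
    refine Or.inr ?_
    fin_cases i <;> fin_cases j <;> simp [SkewDatum.normalize, bookDatum] at hij ⊢

/-- The tensor product of two isomorphisms of bialgebras. -/
noncomputable def BialgEquiv.tensorCongr {A B C D : Type*} [Semiring A] [Semiring B] [Semiring C]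
    [Semiring D] [Bialgebra k A] [Bialgebra k B] [Bialgebra k C] [Bialgebra k D]
    (e : A ≃ₐc[k] C) (f : B ≃ₐc[k] D) : A ⊗[k] B ≃ₐc[k] C ⊗[k] D :=
  BialgEquiv.ofBijective (Bialgebra.TensorProduct.map (e : A →ₐc[k] C) (f : B →ₐc[k] D))
    (TensorProduct.congr (e : A ≃ₗ[k] C) (f : B ≃ₗ[k] D)).bijective

theorem IsTaftNicholsBookTensor.exists_isRealizable [CharZero k] {T : Type u} [Semiring T]
    [HopfAlgebra k T] (hT : IsTaftNicholsBookTensor k T) :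
    ∃ (G ι : Type) (_ : CommGroup G) (_ : Finite ι) (D : SkewDatum k G ι),
      D.IsRealizable ∧ Nonempty (T ≃ₐc[k] D.Alg) := by
  induction hT with
  | taft n hn ζ hζ =>
    exact ⟨_, _, inferInstance, inferInstance, _, isRealizable_taftDatum n hn ζ hζ,
      ⟨BialgEquiv.refl k _⟩⟩
  | nichols n hn =>
    exact ⟨_, _, inferInstance, inferInstance, _, isRealizable_nicholsDatum n,
      ⟨BialgEquiv.refl k _⟩⟩
  | book n hn ζ hζ =>
    exact ⟨_, _, inferInstance, inferInstance, _, isRealizable_normalize_bookDatum n hn ζ hζ,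
      ⟨(bookDatum n hn ζ hζ).normalizeEquiv⟩⟩
  | tensor H₁ H₂ _ _ ih₁ ih₂ =>
    obtain ⟨G₁, ι₁, _, _, D₁, hD₁, ⟨e₁⟩⟩ := ih₁
    obtain ⟨G₂, ι₂, _, _, D₂, hD₂, ⟨e₂⟩⟩ := ih₂
    exact ⟨_, _, inferInstance, inferInstance, _, hD₁.prod hD₂,
      ⟨(e₁.tensorCongr e₂).trans (D₁.prodEquiv D₂)⟩⟩

end Building

/-! ### Necessity of the realizability conditions -/

namespace SkewDatum

section Necessity

variable {k : Type u} [Field k] {G : Type v} [CommGroup G] {ι : Type w} (D : SkewDatum k G ι)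

theorem of_injective : Function.Injective D.of := by
  let φ : D.Alg →ₐ[k] MonoidAlgebra k G := lift (MonoidAlgebra.of k G) (fun _ => 0) (by simp)
    (fun i => zero_pow (D.N_pos i).ne') (by simp)
  intro a b hab
  have h := congrArg φ hab
  rw [lift_of, lift_of] at h
  exact MonoidAlgebra.of_injective h

/-- The generators `x i` survive: there is a representation by triangular matrices of size two in
which `x i` is a matrix unit. -/
theorem x_ne_zero (i : ι) : D.x i ≠ 0 := by
  classical
  let m : G →* Matrix (Fin 2) (Fin 2) k :=
    { toFun := fun a => !![(D.χ i a : k), 0; 0, 1]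
      map_one' := by simp [Matrix.one_fin_two]
      map_mul' := fun a b => by simp }
  have hm : ∀ a, m a = !![(D.χ i a : k), 0; 0, 1] := fun a => rfl
  let y : ι → Matrix (Fin 2) (Fin 2) k := fun j => if j = i then !![0, 1; 0, 0] else 0
  have hyy : ∀ j l, y j * y l = 0 := by
    intro j l
    simp only [y]
    split_ifs <;> simp [← Matrix.ext_iff]
  let φ : D.Alg →ₐ[k] Matrix (Fin 2) (Fin 2) k := lift m y
    (by
      intro a j
      simp only [y]
      split_ifs with h
      · subst h
        simp [hm]
      · simp)
    (by
      intro j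
      rw [← Nat.sub_add_cancel (D.two_le j), pow_add, pow_two, hyy, mul_zero])
    (by
      intro j l _
      rw [hyy, hyy, smul_zero])
  intro h0
  have h := congrArg φ h0
  rw [lift_x, map_zero] at h
  simpa [y] using congrFun (congrFun h 0) 1

/-- If a Hopf algebra which acts inner faithfully on a field embeds in the presented Hopf algebra
with an image containing all `g i` and `x i`, then the datum is realizable. -/
theorem isRealizable_of_isInnerFaithful [Finite G] (hh : ∀ i, D.h i = 1) {H : Type*} [Ring H]
    [HopfAlgebra k H] {L : Type*} [Field L] [Algebra k L] [Module H L] [IsScalarTower k H L]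
    [IsHopfAction k H L] (hL : IsInnerFaithful k H L) (ψ : H →ₐc[k] D.Alg)
    (hψ : Function.Injective ψ) (hg : ∀ i, D.of (D.g i) ∈ Set.range ψ)
    (hx : ∀ i, D.x i ∈ Set.range ψ) : D.IsRealizable := by
  choose t ht using hg
  choose y hy using hx
  have hψψ : Function.Injective
      (TensorProduct.map (ψ : H →ₗ[k] D.Alg) (ψ : H →ₗ[k] D.Alg)) :=
    TensorProduct.map_injective_of_flat_flat _ _ hψ hψ
  have hΔt : ∀ i, Coalgebra.comul (R := k) (t i) = t i ⊗ₜ[k] t i := fun i => hψψ (by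
    rw [CoalgHomClass.map_comp_comul_apply, ht]
    simp [ht])
  have hΔy : ∀ i, Coalgebra.comul (R := k) (y i) = t i ⊗ₜ[k] y i + y i ⊗ₜ[k] 1 := fun i =>
    hψψ (by
      rw [CoalgHomClass.map_comp_comul_apply, hy]
      simp [ht, hy, hh])
  have hεt : ∀ i, Coalgebra.counit (R := k) (t i) = 1 := fun i => by
    rw [← CoalgHomClass.counit_comp_apply ψ, ht, counit_of]
  have hεy : ∀ i, Coalgebra.counit (R := k) (y i) = 0 := fun i => by
    rw [← CoalgHomClass.counit_comp_apply ψ, hy, counit_x]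
  have hu : ∀ i, IsUnit (t i) := fun i => by
    refine IsUnit.of_pow_eq_one (n := Nat.card G) (hψ ?_) Nat.card_pos.ne'
    rw [map_pow, ht, ← map_pow, pow_card_eq_one', map_one, map_one]
  have htt : ∀ i j, t i * t j = t j * t i := fun i j => hψ (by
    rw [map_mul, map_mul, ht, ht, ← map_mul, mul_comm, map_mul])
  have hq : ∀ i j, i ≠ j → (D.χ j (D.g i) : k) = D.c i j := fun i j hij => by
    rw [D.χ_g_eq hh hij]
  obtain ⟨h₁, h₂⟩ := relations_of_action (L := L) (t := t) (y := y)
    (q := fun i j => (D.χ j (D.g i) : k)) (n := D.N) hΔt hΔy hu htt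
    (fun i j => hψ (by rw [map_mul, map_smul, map_mul, ht, hy, of_mul_x]))
    (D.primitive_of_h_eq_one hh) D.N_pos
    (fun i => hψ (by rw [map_pow, hy, x_pow, map_zero]))
    (fun i j hij => hψ (by rw [map_mul, map_smul, map_mul, hy, hy, hq i j hij, x_mul_x D hij]))
    (fun i j hij => by
      rw [hq i j hij, ← Units.val_mul, D.c_mul_χ_g hh hij, Units.val_one])
    (fun i => by
      by_contra! h
      have h1 := hL.eq_one_of_grouplike (hΔt i) (hεt i) (hu i) h
      refine D.g_ne_one hh i (D.of_injective ?_)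
      rw [← ht, h1, map_one, map_one])
    (fun i => by
      by_contra! h
      have h1 := hL.eq_zero_of_skew (hΔt i) (hεt i) (hu i) (hΔy i) (hεy i) h
      exact D.x_ne_zero i (by rw [← hy, h1, map_zero]))
  refine ⟨hh, fun i => ?_, fun i j hij => ?_⟩
  · have h := hL.eq_one_of_grouplike (t := t i ^ D.N i)
      (by rw [Bialgebra.comul_pow, hΔt, Algebra.TensorProduct.tmul_pow])
      (by rw [Bialgebra.counit_pow, hεt, one_pow]) ((hu i).pow _) (h₁ i)
    refine D.of_injective ?_
    rw [map_pow, ← ht, ← map_pow, h, map_one, map_one]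
  · refine (h₂ i j hij).imp (fun h => Units.ext ?_) fun h => ?_
    · rw [← hq i j hij, h, Units.val_one]
    · have h' := hL.eq_one_of_grouplike (t := t i * t j)
        (by rw [Bialgebra.comul_mul, hΔt, hΔt, Algebra.TensorProduct.tmul_mul_tmul])
        (by rw [Bialgebra.counit_mul, hεt, hεt, one_mul]) ((hu i).mul (hu j)) h
      refine D.of_injective ?_
      rw [map_mul, ← ht, ← ht, ← map_mul, h', map_one, map_one]

theorem isGaloisTheoretical_iff_isRealizable [Finite G] [Finite ι] (hh : ∀ i, D.h i = 1) :
    IsGaloisTheoretical k D.Alg ↔ D.IsRealizable := by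
  refine ⟨?_, fun hD => hD.isGaloisTheoretical⟩
  rintro ⟨L, _, _, _, _, _, hL⟩
  exact isRealizable_of_isInnerFaithful D hh hL (BialgHom.id k D.Alg) Function.injective_id
    (fun i => ⟨_, rfl⟩) (fun i => ⟨_, rfl⟩)

end Necessity

/-! ### Invariants and Galois extensions -/

section Invariants

variable {k : Type u} [Field k] {G : Type v} [CommGroup G] {ι : Type w} {D : SkewDatum k G ι}

theorem eq_one_of_smul_eq {M : Type*} [AddCommGroup M] [Module D.Alg M]
    (hM : IsInnerFaithful k D.Alg M) {a : G} (h : ∀ l : M, D.of a • l = l) : a = 1 := by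
  refine D.of_injective ?_
  rw [map_one]
  exact hM.eq_one_of_grouplike (D.comul_of a) (D.counit_of a) ((Group.isUnit a).map D.of) h

variable {L : Type*} [Field L] [Algebra k L] [Module D.Alg L] [IsScalarTower k D.Alg L]

/-- The elements of a Hopf algebra acting on `l` through the counit. -/
def counitStabilizer {H : Type*} [Ring H] [HopfAlgebra k H] [Module H L] [IsScalarTower k H L]
    (l : L) : Subalgebra k H where
  carrier := {h | h • l = algebraMap k L (Coalgebra.counit h) * l}
  mul_mem' {a b} ha hb := by
    have ha' : a • l = algebraMap k L (Coalgebra.counit a) * l := ha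
    have hb' : b • l = algebraMap k L (Coalgebra.counit b) * l := hb
    change (a * b) • l = _
    rw [mul_smul, hb', ← Algebra.smul_def, smul_algebra_smul_comm, ha', Bialgebra.counit_mul,
      map_mul, Algebra.smul_def]
    ring
  add_mem' {a b} ha hb := by
    have ha' : a • l = algebraMap k L (Coalgebra.counit a) * l := ha
    have hb' : b • l = algebraMap k L (Coalgebra.counit b) * l := hb
    change (a + b) • l = _
    rw [add_smul, ha', hb', map_add, map_add, add_mul]
  algebraMap_mem' r := by
    change algebraMap k H r • l = _
    rw [algebraMap_smul, Bialgebra.counit_algebraMap, Algebra.smul_def]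

theorem of_mem_counitStabilizer {a : G} {l : L} :
    D.of a ∈ counitStabilizer (k := k) l ↔ D.of a • l = l := by
  change D.of a • l = _ ↔ _
  rw [counit_of, map_one, one_mul]

theorem x_mem_counitStabilizer {i : ι} {l : L} :
    D.x i ∈ counitStabilizer (k := k) l ↔ D.x i • l = 0 := by
  change D.x i • l = _ ↔ _
  rw [counit_x, map_zero, zero_mul]

variable [IsHopfAction k D.Alg L]

theorem of_smul_mul (a : G) (l m : L) : D.of a • (l * m) = (D.of a • l) * (D.of a • m) :=
  smul_mul_of_comul_tmul (D.comul_of a) l m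

theorem of_smul_one (a : G) : D.of a • (1 : L) = 1 := by
  rw [IsHopfAction.smul_one (k := k), counit_of, map_one]

/-- As `x i` acts by a multiple of `g i - 1`, it kills the elements fixed by `g i`. -/
theorem x_smul_eq_zero (hh : ∀ i, D.h i = 1) (hL : IsInnerFaithful k D.Alg L) {i : ι} {l : L}
    (hl : D.of (D.g i) • l = l) : D.x i • l = 0 := by
  obtain ⟨w, hw⟩ := exists_smul_eq_mul_sub (k := k) (L := L) (t := D.of (D.g i)) (y := D.x i)
    (by rw [comul_x, hh, map_one])
    (by
      by_contra! h
      exact D.g_ne_one hh i (eq_one_of_smul_eq hL h))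
  rw [hw, hl, sub_self, mul_zero]

theorem hopfInvariants_top (hh : ∀ i, D.h i = 1) (hL : IsInnerFaithful k D.Alg L) :
    hopfInvariants L (⊤ : Subalgebra k D.Alg) = (D.fixedField L ⊤ : Set L) := by
  ext l
  refine ⟨fun h a _ => of_mem_counitStabilizer.mp (h (D.of a) trivial), fun h b _ => ?_⟩
  change b ∈ counitStabilizer (k := k) l
  induction b using alg_induction with
  | hk r => exact Subalgebra.algebraMap_mem _ r
  | hof a => exact of_mem_counitStabilizer.mpr (h a trivial)
  | hx i => exact x_mem_counitStabilizer.mpr (x_smul_eq_zero hh hL (h _ trivial))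
  | hmul a b ha hb => exact Subalgebra.mul_mem _ (ha trivial) (hb trivial)
  | hadd a b ha hb => exact Subalgebra.add_mem _ (ha trivial) (hb trivial)

theorem hopfInvariants_minimalSubalgebra (hh : ∀ i, D.h i = 1) (hL : IsInnerFaithful k D.Alg L) :
    hopfInvariants L D.minimalSubalgebra
      = (D.fixedField L (Subgroup.closure (Set.range D.g)) : Set L) := by
  ext l
  constructor
  · intro h a ha
    induction ha using Subgroup.closure_induction with
    | mem a ha =>
      obtain ⟨i, rfl⟩ := ha
      exact of_mem_counitStabilizer.mp
        (h _ (Algebra.subset_adjoin (Or.inl ⟨i, rfl⟩)))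
    | one => rw [map_one, one_smul]
    | mul a b _ _ ha hb => rw [map_mul, mul_smul, hb, ha]
    | inv a _ ha =>
      have h1 := congrArg (fun m => D.of a⁻¹ • m) ha
      rwa [← mul_smul, of_inv_mul_of, one_smul, eq_comm] at h1
  · intro h b hb
    have hle : D.minimalSubalgebra ≤ counitStabilizer (k := k) l := by
      refine Algebra.adjoin_le ?_
      have hfix : ∀ i, D.of (D.g i) • l = l := fun i => h _ (Subgroup.subset_closure ⟨i, rfl⟩)
      rintro _ (⟨i, rfl⟩ | ⟨i, rfl⟩)
      · exact of_mem_counitStabilizer.mpr (hfix i)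
      · exact x_mem_counitStabilizer.mpr (x_smul_eq_zero hh hL (hfix i))
    exact hle hb

/-- Artin's theorem for the faithful action of a subgroup of `G` on the field. -/
theorem isGalois_fixedField [Finite G] (hL : IsInnerFaithful k D.Alg L) (K : Subgroup G) :
    FiniteDimensional (D.fixedField L K) L ∧ IsGalois (D.fixedField L K) L := by
  let : MulSemiringAction K L :=
    { smul := fun a l => D.of a.1 • l
      one_smul := fun l => by
        change D.of ((1 : K) : G) • l = l
        rw [Subgroup.coe_one, map_one, one_smul]
      mul_smul := fun a b l => by
        change D.of ((a * b : K) : G) • l = D.of a.1 • D.of b.1 • l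
        rw [Subgroup.coe_mul, map_mul, mul_smul]
      smul_zero := fun a => smul_zero _
      smul_add := fun a l m => smul_add _ l m
      smul_one := fun a => of_smul_one a.1
      smul_mul := fun a l m => of_smul_mul a.1 l m }
  have hsmul : ∀ (a : K) (l : L), a • l = D.of a.1 • l := fun a l => rfl
  have : IsGaloisGroup K (D.fixedField L K) L :=
    { faithful := ⟨fun {a b} hab => by
        have h : a⁻¹ * b = 1 := Subtype.ext (eq_one_of_smul_eq hL fun l => by
          rw [← hsmul, mul_smul, ← hab, inv_smul_smul])
        exact inv_mul_eq_one.mp h⟩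
      commutes := ⟨fun a c l => by
        rw [hsmul, hsmul, Algebra.smul_def, Algebra.smul_def, of_smul_mul]
        congr 1
        exact c.2 a.1 a.2⟩
      isInvariant := ⟨fun l hl => ⟨⟨l, fun a ha => hl ⟨a, ha⟩⟩, rfl⟩⟩ }
  exact ⟨IsGaloisGroup.finiteDimensional K _ L, IsGaloisGroup.isGalois K _ L⟩

end Invariants

end SkewDatum

/-! ### Decomposition into Taft, Nichols and book algebras -/

section Cyclic

theorem exists_eq_cyclicGen_pow {n : ℕ} (hn : 0 < n) (a : Multiplicative (ZMod n)) :
    ∃ m : ℕ, a = cyclicGen n ^ m := by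
  have : NeZero n := ⟨hn.ne'⟩
  refine ⟨(Multiplicative.toAdd a).val, ?_⟩
  rw [cyclicGen, ← ofAdd_nsmul, nsmul_eq_mul, mul_one, ZMod.natCast_zmod_val, ofAdd_toAdd]

/-- The homomorphism from the cyclic group of order `n` sending the standard generator to `g`. -/
def cyclicHom {G : Type*} [CommGroup G] (n : ℕ) (g : G) (hg : g ^ n = 1) :
    Multiplicative (ZMod n) →* G :=
  AddMonoidHom.toMultiplicativeLeft
    (ZMod.lift n ⟨zmultiplesHom (Additive G) (Additive.ofMul g), by
      rw [zmultiplesHom_apply, natCast_zsmul, ← ofMul_pow, hg, ofMul_one]⟩)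

@[simp] theorem cyclicHom_gen {G : Type*} [CommGroup G] (n : ℕ) (g : G) (hg : g ^ n = 1) :
    cyclicHom n g hg (cyclicGen n) = g := by
  have h := ZMod.lift_coe n ⟨zmultiplesHom (Additive G) (Additive.ofMul g), by
      rw [zmultiplesHom_apply, natCast_zsmul, ← ofMul_pow, hg, ofMul_one]⟩ 1
  rw [Int.cast_one] at h
  exact (congrArg Additive.toMul h).trans (by simp)

end Cyclic

namespace SkewDatum

section Embedding

variable {k : Type u} [Field k] {G : Type v} [CommGroup G] {ι : Type w}
  {G' ι' : Type*} [CommGroup G']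

/-- The datum `D'` is identified by `j` and `e` with the part of `D` generated by the indices in
`S`, and the characters of `D'` separate the elements of its group. -/
structure EmbedsIn (D' : SkewDatum k G' ι') (D : SkewDatum k G ι) (S : Set ι) (j : G' →* G)
    (e : ι' → ι) : Prop where
  h_eq_one : ∀ i, D'.h i = 1
  e_injective : Function.Injective e
  e_range : Set.range e = S
  map_g : ∀ i, j (D'.g i) = D.g (e i)
  χ_eq : ∀ i a, D'.χ i a = D.χ (e i) (j a)
  j_mem : ∀ a, j a ∈ Subgroup.closure (D.g '' S)
  separating : ∀ a, (∀ i, D'.χ i a = 1) → a = 1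

namespace EmbedsIn

variable {D' : SkewDatum k G' ι'} {D : SkewDatum k G ι} {S : Set ι} {j : G' →* G} {e : ι' → ι}

theorem j_injective (hE : EmbedsIn D' D S j e) : Function.Injective j :=
  (injective_iff_map_eq_one j).mpr fun a ha => hE.separating a fun i => by
    rw [hE.χ_eq, ha, map_one]

theorem N_eq (hE : EmbedsIn D' D S j e) (hh : ∀ i, D.h i = 1) (i : ι') :
    D'.N i = D.N (e i) := by
  refine (D'.primitive_of_h_eq_one hE.h_eq_one i).unique ?_
  rw [hE.χ_eq, hE.map_g]
  exact D.primitive_of_h_eq_one hh (e i)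

theorem c_eq (hE : EmbedsIn D' D S j e) (hh : ∀ i, D.h i = 1) {i l : ι'} (hil : i ≠ l) :
    D'.c i l = D.c (e i) (e l) := by
  rw [← D'.χ_g_eq hE.h_eq_one hil, hE.χ_eq, hE.map_g, D.χ_g_eq hh (hE.e_injective.ne hil)]

/-- The homomorphism of presented algebras induced by an embedding of data. -/
noncomputable def algHom (hE : EmbedsIn D' D S j e) (hh : ∀ i, D.h i = 1) : D'.Alg →ₐ[k] D.Alg :=
  lift (D.of.comp j) (fun i => D.x (e i))
    (fun a i => by rw [hE.χ_eq, MonoidHom.comp_apply, of_mul_x])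
    (fun i => by rw [hE.N_eq hh, x_pow])
    (fun i l hil => by rw [hE.c_eq hh hil, x_mul_x D (hE.e_injective.ne hil)])

theorem algHom_of (hE : EmbedsIn D' D S j e) (hh : ∀ i, D.h i = 1) (a : G') :
    hE.algHom hh (D'.of a) = D.of (j a) :=
  lift_of _ _ _ _ _ a

theorem algHom_x (hE : EmbedsIn D' D S j e) (hh : ∀ i, D.h i = 1) (i : ι') :
    hE.algHom hh (D'.x i) = D.x (e i) :=
  lift_x _ _ _ _ _ i

/-- The homomorphism of presented Hopf algebras induced by an embedding of data. -/
noncomputable def bialgHom (hE : EmbedsIn D' D S j e) (hh : ∀ i, D.h i = 1) :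
    D'.Alg →ₐc[k] D.Alg :=
  BialgHom.ofAlgHom (hE.algHom hh)
    (hom_ext (fun a => by simp [algHom_of]) fun i => by simp [algHom_x])
    (hom_ext (fun a => by simp [algHom_of]) fun i => by
      simp [algHom_x, algHom_of, hE.map_g, hh, hE.h_eq_one])

theorem bialgHom_injective [Finite ι'] (hE : EmbedsIn D' D S j e) (hD : D.IsRealizable) :
    Function.Injective (hE.bialgHom hD.h_eq_one) :=
  hD.injective_of_embedding hE.h_eq_one _ hE.j_injective hE.e_injective
    (hE.algHom_of hD.h_eq_one) (hE.algHom_x hD.h_eq_one) hE.map_g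

theorem algHom_range [Finite G] (hE : EmbedsIn D' D Set.univ j e) (hh : ∀ i, D.h i = 1) :
    (hE.algHom hh).range = D.minimalSubalgebra := by
  apply le_antisymm
  · rintro _ ⟨a, rfl⟩
    change hE.algHom hh a ∈ D.minimalSubalgebra
    induction a using alg_induction with
    | hk r => rw [AlgHom.commutes]; exact Subalgebra.algebraMap_mem _ r
    | hof a =>
      rw [algHom_of]
      have hja := hE.j_mem a
      rw [Set.image_univ] at hja
      generalize j a = b at hja ⊢
      induction hja using Subgroup.closure_induction with
      | mem b hb =>
        obtain ⟨i, rfl⟩ := hb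
        exact Algebra.subset_adjoin (Or.inl ⟨i, rfl⟩)
      | one => rw [map_one]; exact Subalgebra.one_mem _
      | mul b c _ _ hb hc => rw [map_mul]; exact Subalgebra.mul_mem _ hb hc
      | inv b _ hb =>
        have h1 : b⁻¹ = b ^ (Nat.card G - 1) := by
          rw [inv_eq_iff_mul_eq_one, ← pow_succ', Nat.sub_add_cancel Nat.card_pos,
            pow_card_eq_one']
        rw [h1, map_pow]
        exact Subalgebra.pow_mem _ hb _
    | hx i => rw [algHom_x]; exact Algebra.subset_adjoin (Or.inr ⟨e i, rfl⟩)
    | hmul a b ha hb => rw [map_mul]; exact Subalgebra.mul_mem _ ha hb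
    | hadd a b ha hb => rw [map_add]; exact Subalgebra.add_mem _ ha hb
  · refine Algebra.adjoin_le ?_
    have hsurj : ∀ i, ∃ l, e l = i := Set.range_eq_univ.mp hE.e_range
    rintro _ (⟨i, rfl⟩ | ⟨i, rfl⟩)
    · obtain ⟨l, rfl⟩ := hsurj i
      exact ⟨D'.of (D'.g l), by rw [AlgHom.toRingHom_eq_coe, RingHom.coe_coe, algHom_of, hE.map_g]⟩
    · obtain ⟨l, rfl⟩ := hsurj i
      exact ⟨D'.x l, by rw [AlgHom.toRingHom_eq_coe, RingHom.coe_coe, algHom_x]⟩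

/-- Parts of `D` belonging to disjoint sets of indices whose generators commute can be combined. -/
theorem prod {G₁ G₂ ι₁ ι₂ : Type*} [CommGroup G₁] [CommGroup G₂] {D₁ : SkewDatum k G₁ ι₁}
    {D₂ : SkewDatum k G₂ ι₂} {S₁ S₂ : Set ι} {j₁ : G₁ →* G} {j₂ : G₂ →* G} {e₁ : ι₁ → ι}
    {e₂ : ι₂ → ι} (h₁ : EmbedsIn D₁ D S₁ j₁ e₁) (h₂ : EmbedsIn D₂ D S₂ j₂ e₂)
    (hS : Disjoint S₁ S₂) (h₁₂ : ∀ i ∈ S₁, ∀ l ∈ S₂, D.χ l (D.g i) = 1 ∧ D.χ i (D.g l) = 1) :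
    EmbedsIn (D₁.prod D₂) D (S₁ ∪ S₂) (j₁.coprod j₂) (Sum.elim e₁ e₂) := by
  have hclosure : ∀ (S : Set ι) (i : ι), (∀ l ∈ S, D.χ i (D.g l) = 1) →
      ∀ a ∈ Subgroup.closure (D.g '' S), D.χ i a = 1 := by
    intro S i h a ha
    have hle : Subgroup.closure (D.g '' S) ≤ (D.χ i).ker := by
      rw [Subgroup.closure_le]
      rintro _ ⟨l, hl, rfl⟩
      exact h l hl
    exact hle ha
  have hmem₁ : ∀ i, e₁ i ∈ S₁ := fun i => h₁.e_range ▸ ⟨i, rfl⟩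
  have hmem₂ : ∀ i, e₂ i ∈ S₂ := fun i => h₂.e_range ▸ ⟨i, rfl⟩
  refine ⟨?_, ?_, ?_, ?_, ?_, ?_, ?_⟩
  · rintro (i | i)
    · rw [prod_h_inl, h₁.h_eq_one]; rfl
    · rw [prod_h_inr, h₂.h_eq_one]; rfl
  · refine h₁.e_injective.sumElim h₂.e_injective fun i l hil => ?_
    exact Set.disjoint_left.mp hS (hmem₁ i) (hil ▸ hmem₂ l)
  · rw [Set.Sum.elim_range, h₁.e_range, h₂.e_range]
  · rintro (i | i)
    · simp [h₁.map_g]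
    · simp [h₂.map_g]
  · rintro (i | i) a
    · rw [prod_χ_inl, Sum.elim_inl, MonoidHom.coprod_apply, map_mul,
        hclosure S₂ (e₁ i) (fun l hl => (h₁₂ _ (hmem₁ i) l hl).2) _ (h₂.j_mem a.2), mul_one,
        h₁.χ_eq]
    · rw [prod_χ_inr, Sum.elim_inr, MonoidHom.coprod_apply, map_mul,
        hclosure S₁ (e₂ i) (fun l hl => (h₁₂ l hl _ (hmem₂ i)).1) _ (h₁.j_mem a.1), one_mul,
        h₂.χ_eq]
  · intro a
    rw [MonoidHom.coprod_apply]
    exact mul_mem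
      (Subgroup.closure_mono (Set.image_mono Set.subset_union_left) (h₁.j_mem a.1))
      (Subgroup.closure_mono (Set.image_mono Set.subset_union_right) (h₂.j_mem a.2))
  · intro a ha
    exact Prod.ext (h₁.separating a.1 fun i => ha (Sum.inl i))
      (h₂.separating a.2 fun i => ha (Sum.inr i))

/-- An embedding of a datum over a cyclic group can be checked on the generator. -/
theorem of_cyclic {n : ℕ} (hn : 0 < n) {ι' : Type*} {D' : SkewDatum k (Multiplicative (ZMod n)) ι'}
    {ζ : kˣ} (hζ : IsPrimitiveRoot ζ n) {γ : G} (hγ : γ ^ n = 1) {e : ι' → ι} (i₀ : ι')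
    (hh : ∀ i, D'.h i = 1) (he : Function.Injective e) (hS : Set.range e = S)
    (hg : ∀ i, cyclicHom n γ hγ (D'.g i) = D.g (e i)) (hγS : γ ∈ Subgroup.closure (D.g '' S))
    (hχ' : ∀ i, D'.χ i (cyclicGen n) = ζ) (hχ : ∀ i, D.χ (e i) γ = ζ) :
    EmbedsIn D' D S (cyclicHom n γ hγ) e := by
  refine ⟨hh, he, hS, hg, fun i a => ?_, fun a => ?_, fun a ha => ?_⟩
  · obtain ⟨m, rfl⟩ := exists_eq_cyclicGen_pow hn a
    rw [map_pow, map_pow, map_pow, hχ', cyclicHom_gen, hχ]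
  · obtain ⟨m, rfl⟩ := exists_eq_cyclicGen_pow hn a
    rw [map_pow, cyclicHom_gen]
    exact Subgroup.pow_mem _ hγS m
  · obtain ⟨m, rfl⟩ := exists_eq_cyclicGen_pow hn a
    have h := ha i₀
    rw [map_pow, hχ', hζ.pow_eq_one_iff_dvd] at h
    obtain ⟨l, rfl⟩ := h
    rw [pow_mul, cyclicGen_pow, one_pow]

end EmbedsIn

end Embedding

section Decomposition

variable {k : Type u} [Field k] [CharZero k] {G : Type v} [CommGroup G] {ι : Type w}

/-- The part of `D` generated by the indices in `S` presents a tensor product of Taft, Nichols and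
book algebras. -/
def HasTensorModel (D : SkewDatum k G ι) (S : Set ι) : Prop :=
  ∃ (T : Type u) (_ : Semiring T) (_ : HopfAlgebra k T), IsTaftNicholsBookTensor k T ∧
    ∃ (G' ι' : Type) (_ : CommGroup G') (_ : Finite ι') (D' : SkewDatum k G' ι') (j : G' →* G)
      (e : ι' → ι), Nonempty (T ≃ₐc[k] D'.Alg) ∧ D'.EmbedsIn D S j e

theorem HasTensorModel.union {D : SkewDatum k G ι} {S₁ S₂ : Set ι} (h₁ : D.HasTensorModel S₁)
    (h₂ : D.HasTensorModel S₂) (hS : Disjoint S₁ S₂)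
    (h₁₂ : ∀ i ∈ S₁, ∀ l ∈ S₂, D.χ l (D.g i) = 1 ∧ D.χ i (D.g l) = 1) :
    D.HasTensorModel (S₁ ∪ S₂) := by
  obtain ⟨T₁, _, _, hT₁, G₁, ι₁, _, _, D₁, j₁, e₁, ⟨f₁⟩, hE₁⟩ := h₁
  obtain ⟨T₂, _, _, hT₂, G₂, ι₂, _, _, D₂, j₂, e₂, ⟨f₂⟩, hE₂⟩ := h₂
  exact ⟨T₁ ⊗[k] T₂, _, _, .tensor T₁ T₂ hT₁ hT₂, _, _, _, inferInstance, D₁.prod D₂, _, _,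
    ⟨(f₁.tensorCongr f₂).trans (D₁.prodEquiv D₂)⟩, hE₁.prod hE₂ hS h₁₂⟩

/-- A class of indices `l` with `g l = g i` or `g l = (g i)⁻¹`, on all of which `g i` acts with the
same eigenvalue, generates a Nichols algebra if that eigenvalue is `-1`; otherwise the class has at
most two elements, and they generate a Taft algebra or a book algebra. -/
theorem IsRealizable.hasTensorModel_class {D : SkewDatum k G ι} (hD : D.IsRealizable) {i : ι}
    {S : Set ι} [Finite S] (hi : i ∈ S) (hS : ∀ l ∈ S, l ≠ i → D.g l = (D.g i)⁻¹)
    (hχ : ∀ l ∈ S, D.χ l (D.g i) = D.χ i (D.g i)) : D.HasTensorModel S := by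
  have hζ : IsPrimitiveRoot (D.χ i (D.g i)) (D.N i) := by
    simpa [hD.h_eq_one] using D.primitive i
  have hgS : D.g i ∈ Subgroup.closure (D.g '' S) := Subgroup.subset_closure ⟨i, hi, rfl⟩
  rcases (D.two_le i).eq_or_lt with h2 | h2
  · -- all `g l` agree, as they are of order two
    have hg2 : D.g i ^ 2 = 1 := by rw [h2]; exact hD.g_pow i
    have hgl : ∀ l ∈ S, D.g l = D.g i := by
      intro l hl
      by_cases hli : l = i
      · rw [hli]
      · rw [hS l hl hli, inv_eq_iff_mul_eq_one, ← pow_two, hg2]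
    have hζ2 : D.χ i (D.g i) = -1 := by
      have h := D.primitive_of_h_eq_one hD.h_eq_one i
      rw [← h2] at h
      ext
      rw [Units.val_neg, Units.val_one]
      exact h.eq_neg_one_of_two_right
    let f := Finite.equivFin S
    have hcard : 1 ≤ Nat.card S := Nat.card_pos_iff.mpr ⟨⟨⟨i, hi⟩⟩, inferInstance⟩
    refine ⟨_, _, _, .nichols (Nat.card S) hcard, _, _, _, inferInstance,
      nicholsDatum k (Nat.card S), cyclicHom 2 (D.g i) hg2, fun l => (f.symm l : ι),
      ⟨BialgEquiv.refl k _⟩, ?_⟩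
    refine EmbedsIn.of_cyclic two_pos (ζ := -1) (by rw [← hζ2, h2]; exact hζ) hg2 (f ⟨i, hi⟩)
      (fun _ => rfl) (Subtype.val_injective.comp f.symm.injective) ?_ (fun l => ?_) hgS
      (fun l => ?_) (fun l => ?_)
    · ext l
      exact ⟨by rintro ⟨m, rfl⟩; exact (f.symm m).2, fun hl =>
        ⟨f ⟨l, hl⟩, congrArg Subtype.val (f.symm_apply_apply ⟨l, hl⟩)⟩⟩
    · rw [hgl _ (f.symm l).2]
      exact cyclicHom_gen _ _ _
    · exact cyclicChar_gen 2 (-1) (by simp)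
    · rw [hχ _ (f.symm l).2, hζ2]
  · by_cases hex : ∃ l ∈ S, l ≠ i
    · obtain ⟨l, hl, hli⟩ := hex
      have hgl := hS l hl hli
      have hSl : S = {l, i} := by
        refine Set.Subset.antisymm (fun m hm => ?_) ?_
        · by_contra hm'
          rw [Set.mem_insert_iff, Set.mem_singleton_iff, not_or] at hm'
          -- three indices would force `g i ^ 2 = 1`
          have hgm := hS m hm hm'.2
          have h1 : D.χ m (D.g l) = (D.χ i (D.g i))⁻¹ := by rw [hgl, map_inv, hχ m hm]
          rcases hD.comm l m (Ne.symm hm'.1) with h3 | h3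
          · rw [← D.χ_g_eq hD.h_eq_one (Ne.symm hm'.1), h1, inv_eq_one] at h3
            rw [h3] at hζ
            have := hζ.unique IsPrimitiveRoot.one
            omega
          · rw [hgl, hgm, ← mul_inv, inv_eq_one, ← pow_two] at h3
            have h4 := congrArg (D.χ i) h3
            rw [map_pow, map_one] at h4
            have := Nat.le_of_dvd two_pos (hζ.dvd_of_pow_eq_one 2 h4)
            omega
        · rintro m (rfl | rfl)
          · exact hl
          · exact hi
      refine ⟨_, _, _, .book (D.N i) (D.two_le i) _ hζ, _, _, _, inferInstance,
        (bookDatum (D.N i) (D.two_le i) _ hζ).normalize, cyclicHom (D.N i) (D.g i) (hD.g_pow i),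
        ![l, i], ⟨normalizeEquiv _⟩, ?_⟩
      refine EmbedsIn.of_cyclic (D.N_pos i) hζ (hD.g_pow i) 0 (fun _ => rfl) ?_ ?_ (fun m => ?_)
        hgS (fun m => ?_) (fun m => ?_)
      · intro m m' h
        fin_cases m <;> fin_cases m' <;> simp [hli, Ne.symm hli] at h ⊢
      · rw [hSl]
        simp [Set.pair_comm]
      · fin_cases m <;> simp [bookDatum, hgl]
      · exact cyclicChar_gen _ _ hζ.pow_eq_one
      · fin_cases m
        · exact hχ l hl
        · rfl
    · push Not at hex
      refine ⟨_, _, _, .taft (D.N i) (D.two_le i) _ hζ, _, _, _, inferInstance,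
        taftDatum (D.N i) (D.two_le i) _ hζ, cyclicHom (D.N i) (D.g i) (hD.g_pow i), fun _ => i,
        ⟨BialgEquiv.refl k _⟩, ?_⟩
      refine EmbedsIn.of_cyclic (D.N_pos i) hζ (hD.g_pow i) () (fun _ => rfl)
        (fun _ _ _ => rfl) ?_ (fun _ => cyclicHom_gen _ _ _) hgS
        (fun _ => cyclicChar_gen _ _ hζ.pow_eq_one) (fun _ => rfl)
      ext l
      exact ⟨by rintro ⟨m, rfl⟩; exact hi, fun hl => ⟨(), (hex l hl).symm⟩⟩

/-- The indices fall into classes, two indices being equivalent if they are equal or `c i l ≠ 1`.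
Distinct classes do not interact, so the algebra is the tensor product of the parts which they
generate. -/
theorem IsRealizable.hasTensorModel_of_closed {D : SkewDatum k G ι} (hD : D.IsRealizable)
    (S : Finset ι) (hne : S.Nonempty) (hclosed : ∀ i ∈ S, ∀ l ∉ S, D.c i l = 1) :
    D.HasTensorModel (S : Set ι) := by
  classical
  induction S using Finset.strongInduction with
  | H S ih =>
    obtain ⟨i, hi⟩ := hne
    have hsymm : ∀ i l, i ≠ l → D.c i l * D.c l i = 1 := fun i l hil => by
      rw [← D.χ_g_eq hD.h_eq_one (Ne.symm hil), D.c_mul_χ_g hD.h_eq_one hil]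
    have hg : ∀ l, l ≠ i → D.c i l ≠ 1 → D.g l = (D.g i)⁻¹ := fun l hl h =>
      eq_inv_of_mul_eq_one_right ((hD.comm i l hl.symm).resolve_left h)
    let C := S.filter fun l => l = i ∨ D.c i l ≠ 1
    have hiC : i ∈ C := Finset.mem_filter.mpr ⟨hi, Or.inl rfl⟩
    have hCg : ∀ l ∈ C, l ≠ i → D.g l = (D.g i)⁻¹ := fun l hl hli =>
      hg l hli ((Finset.mem_filter.mp hl).2.resolve_left hli)
    have hCS : ∀ l ∈ C, ∀ m ∉ C, D.c l m = 1 := by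
      intro l hl m hm
      by_cases hmS : m ∈ S
      · have hm' : m ≠ i ∧ D.c i m = 1 := by
          have h : ¬ (m = i ∨ D.c i m ≠ 1) := fun h => hm (Finset.mem_filter.mpr ⟨hmS, h⟩)
          rw [not_or, not_not] at h
          exact h
        by_cases hli : l = i
        · rw [hli, hm'.2]
        · have hlm : l ≠ m := fun h => hm (h ▸ hl)
          rw [← D.χ_g_eq hD.h_eq_one hlm, hCg l hl hli, map_inv,
            D.χ_g_eq hD.h_eq_one hm'.1.symm, hm'.2, inv_one]
      · exact hclosed l (Finset.mem_filter.mp hl).1 m hmS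
    have hC : D.HasTensorModel (C : Set ι) := by
      refine hD.hasTensorModel_class (i := i) hiC hCg fun l hl => ?_
      by_cases hli : l = i
      · rw [hli]
      · have h := hsymm i l (Ne.symm hli)
        rw [← D.χ_g_eq hD.h_eq_one (Ne.symm hli), ← D.χ_g_eq hD.h_eq_one hli,
          hCg l hl hli, map_inv, mul_inv_eq_one] at h
        exact h
    rcases (S \ C).eq_empty_or_nonempty with h0 | h0
    · have h1 : C = S :=
        Finset.Subset.antisymm (Finset.filter_subset _ _) (Finset.sdiff_eq_empty_iff_subset.mp h0)
      rwa [h1] at hC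
    · have hsub : S \ C ⊂ S := by
        refine Finset.ssubset_iff_subset_ne.mpr ⟨Finset.sdiff_subset, fun h => ?_⟩
        have h1 := hi
        rw [← h] at h1
        exact (Finset.mem_sdiff.mp h1).2 hiC
      have hrest := ih (S \ C) hsub h0 fun l hl m hm => by
        obtain ⟨hlS, hlC⟩ := Finset.mem_sdiff.mp hl
        by_cases hmS : m ∈ S
        · have hmC : m ∈ C := by
            by_contra hmC
            exact hm (Finset.mem_sdiff.mpr ⟨hmS, hmC⟩)
          have h := hsymm l m (fun h => hm (h ▸ hl))
          rwa [hCS m hmC l hlC, mul_one] at h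
        · exact hclosed l hlS m hmS
      have hunion := hrest.union hC
        (by
          rw [Finset.disjoint_coe]
          exact Finset.sdiff_disjoint)
        fun l hl m hm => by
          obtain ⟨-, hlC⟩ := Finset.mem_sdiff.mp hl
          have hml : m ≠ l := fun h => hlC (h ▸ hm)
          have h := hsymm m l hml
          rw [hCS m hm l hlC, one_mul] at h
          rw [D.χ_g_eq hD.h_eq_one hml.symm, D.χ_g_eq hD.h_eq_one hml]
          exact ⟨h, hCS m hm l hlC⟩
      rwa [← Finset.coe_union, Finset.sdiff_union_of_subset (Finset.filter_subset _ _)] at hunion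

theorem IsRealizable.exists_tensor [Finite G] [Finite ι] [Nonempty ι] {D : SkewDatum k G ι}
    (hD : D.IsRealizable) :
    ∃ (T : Type u) (_ : Semiring T) (_ : HopfAlgebra k T), IsTaftNicholsBookTensor k T ∧
      ∃ φ : T →ₐc[k] D.Alg, Function.Injective φ ∧
        (φ : T →ₐ[k] D.Alg).range = D.minimalSubalgebra := by
  have := Fintype.ofFinite ι
  obtain ⟨T, hT₁, hT₂, hT, G', ι', _, _, D', j, e, ⟨f⟩, hE⟩ := hD.hasTensorModel_of_closed
    Finset.univ Finset.univ_nonempty fun i _ l hl => absurd (Finset.mem_univ l) hl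
  rw [Finset.coe_univ] at hE
  refine ⟨T, hT₁, hT₂, hT, (hE.bialgHom hD.h_eq_one).comp (f : T →ₐc[k] D'.Alg),
    (hE.bialgHom_injective hD).comp f.toEquiv.injective, ?_⟩
  rw [← hE.algHom_range hD.h_eq_one]
  ext a
  constructor
  · rintro ⟨b, rfl⟩
    exact ⟨f b, rfl⟩
  · rintro ⟨b, rfl⟩
    exact ⟨f.symm b, congrArg (hE.algHom hD.h_eq_one) (f.apply_symm_apply b)⟩

/-- The tensor product acts inner faithfully on a field; its group-likes and skew-primitives which
correspond to the generators of the minimal subalgebra then satisfy the realizability conditions. -/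
theorem isRealizable_of_exists_tensor [Finite G] {D : SkewDatum k G ι} (hh : ∀ i, D.h i = 1)
    {T : Type u} [Semiring T] [HopfAlgebra k T] (hT : IsTaftNicholsBookTensor k T)
    (φ : T →ₐc[k] D.Alg) (hφ : Function.Injective φ)
    (hrange : (φ : T →ₐ[k] D.Alg).range = D.minimalSubalgebra) : D.IsRealizable := by
  obtain ⟨G', ι', _, _, D', hD', ⟨f⟩⟩ := hT.exists_isRealizable
  have hmem : ∀ a ∈ D.minimalSubalgebra,
      a ∈ Set.range (φ.comp (f.symm : D'.Alg →ₐc[k] T)) := by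
    intro a ha
    rw [← hrange] at ha
    obtain ⟨b, rfl⟩ := ha
    exact ⟨f b, congrArg φ (f.symm_apply_apply b)⟩
  exact isRealizable_of_isInnerFaithful D hh (isInnerFaithful_ratField hD')
    (φ.comp (f.symm : D'.Alg →ₐc[k] T)) (hφ.comp f.symm.toEquiv.injective)
    (fun i => hmem _ (Algebra.subset_adjoin (Or.inl ⟨i, rfl⟩)))
    (fun i => hmem _ (Algebra.subset_adjoin (Or.inr ⟨i, rfl⟩)))

end Decomposition

end SkewDatum

theorem theorem4p6 {k : Type u} [Field k] [IsAlgClosed k] [CharZero k] {G : Type v} [CommGroup G]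
    [Finite G] {θ : ℕ} (hθ : 1 ≤ θ) (g : Fin θ → G) (χ : Fin θ → G →* kˣ)
    (hord : ∀ i, 2 ≤ orderOf (χ i (g i)))
    (hbr : ∀ i j, i ≠ j → χ j (g i) * χ i (g j) = 1) :
    (IsGaloisTheoretical k (quantumLinearDatum g χ hord hbr).Alg ↔
      ∃ (T : Type u) (_ : Semiring T) (_ : HopfAlgebra k T), IsTaftNicholsBookTensor k T ∧
        ∃ φ : T →ₐc[k] (quantumLinearDatum g χ hord hbr).Alg, Function.Injective φ ∧
          (φ : T →ₐ[k] (quantumLinearDatum g χ hord hbr).Alg).range =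
            (quantumLinearDatum g χ hord hbr).minimalSubalgebra) ∧
    ∀ (L : Type w) [Field L] [Algebra k L] [Module (quantumLinearDatum g χ hord hbr).Alg L]
      [IsScalarTower k (quantumLinearDatum g χ hord hbr).Alg L]
      [IsHopfAction k (quantumLinearDatum g χ hord hbr).Alg L],
      IsInnerFaithful k (quantumLinearDatum g χ hord hbr).Alg L →
        (hopfInvariants L (⊤ : Subalgebra k (quantumLinearDatum g χ hord hbr).Alg) =
            ((quantumLinearDatum g χ hord hbr).fixedField L ⊤ : Set L) ∧
          FiniteDimensional ((quantumLinearDatum g χ hord hbr).fixedField L ⊤) L ∧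
          IsGalois ((quantumLinearDatum g χ hord hbr).fixedField L ⊤) L) ∧
        (hopfInvariants L (quantumLinearDatum g χ hord hbr).minimalSubalgebra =
            ((quantumLinearDatum g χ hord hbr).fixedField L
              (Subgroup.closure (Set.range g)) : Set L) ∧
          FiniteDimensional ((quantumLinearDatum g χ hord hbr).fixedField L
            (Subgroup.closure (Set.range g))) L ∧
          IsGalois ((quantumLinearDatum g χ hord hbr).fixedField L
            (Subgroup.closure (Set.range g))) L) := by
  have hh : ∀ i, (quantumLinearDatum g χ hord hbr).h i = 1 := fun _ => rfl
  have : Nonempty (Fin θ) := ⟨⟨0, hθ⟩⟩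
  refine ⟨?_, fun L _ _ _ _ _ hL => ⟨⟨SkewDatum.hopfInvariants_top hh hL,
    SkewDatum.isGalois_fixedField hL ⊤⟩, SkewDatum.hopfInvariants_minimalSubalgebra hh hL,
    SkewDatum.isGalois_fixedField hL _⟩⟩
  rw [SkewDatum.isGaloisTheoretical_iff_isRealizable _ hh]
  constructor
  · exact fun hD => hD.exists_tensor
  · rintro ⟨T, _, _, hT, φ, hφ, hrange⟩
    exact SkewDatum.isRealizable_of_exists_tensor hh hT φ hφ hrange
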